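/- **Proposition 2.2.** Let $\Gamma_0$ be a discrete abelian group, let $B$ be a (finite) von Neumann algebra acting on a Hilbert space $H$, let $\tau$ be a trace on $B$, i.e. a normal, faithful, positive linear functional with $\tau(xy)=\tau(yx)$ and $\tau(1)=1$, and let $\alpha$ be an action of $\Gamma_0$ on $B$ by $*$-automorphisms with $\tau\circ\alpha_g=\tau$ for all $g\in\Gamma_0$. Let $M=B\rtimes_\alpha\Gamma_0$ be the crossed product, i.e. the von Neumann algebra on $\ell^2(\Gamma_0,H)$ generated by the operators $(\pi(b)\xi)(g)=\alpha_{g^{-1}}(b)\xi(g)$ for $b\in B$ and $(\lambda(h)\xi)(g)=\xi(h^{-1}g)$ for $h\in\Gamma_0$, with the trace, again denoted $\tau$, that extends the trace of $B$ by $\tau\big(\sum_\gamma \pi(b_\gamma)\lambda(\gamma)\big)=\tau(b_1)$. Put $\Vert x\Vert_2=\tau(x^*x)^{1/2}$ for $x\in M$. Let $A=L(\Gamma_0)\subset M$ be the abelian von Neumann subalgebra generated by $\lambda(\Gamma_0)$, and let $E_A:M\to A$ be the $\tau$-preserving conditional expectation, characterised by $E_A(x)\in A$ and $\tau(E_A(x)a)=\tau(xa)$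 for all $x\in M$, $a\in A$. Then the following are equivalent: 1. $A$ is weakly mixing in $M$: there is a subgroup $G$ of the unitary group $U(A)$ such that for every finite set $F\subset\{x\in M: E_A(x)=0\}$ and every $\varepsilon>0$ there is $v\in G$ with $\Vert E_A(x^*vyv^*)\Vert_2\le\varepsilon$ for all $x,y\in F$. 2. The action $\alpha$ is weakly mixing: for every finite set $F\subset B$ and every $\varepsilon>0$ there is $g\in\Gamma_0$ with $|\tau(\alpha_g(a)b)-\tau(a)\tau(b)|<\varepsilon$ for all $a,b\in F$. -/

import Mathlib

open scoped ENNReal ComplexOrder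

noncomputable section

/-! ### Weak mixing of actions and of subalgebras

The definitions of this first part only involve the `*`-algebra `M` and its trace `τ`. -/

section Mixing

variable {M : Type*} [Ring M] [StarRing M] [Algebra ℂ M] [StarModule ℂ M]

/-- The norm `‖x‖₂ = τ(x* x)^{1/2}` attached to a trace `τ`. -/
def twoNorm (τ : M →ₗ[ℂ] ℂ) (x : M) : ℝ := Real.sqrt (τ (star x * x)).re

/-- The map `α` preserves `τ`: `τ(α_g(x)) = τ(x)`. -/
def PreservesTrace {Γ : Type*} [Group Γ] (τ : M →ₗ[ℂ] ℂ) (α : Γ →* (M ≃⋆ₐ[ℂ] M)) : Prop :=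
  ∀ g x, τ (α g x) = τ x

/-- A trace-preserving action `α` of `Γ` on `M` is *weakly mixing* if for every finite set
`F ⊆ M` and every `ε > 0` there is `g` with `|τ(α_g(a) b) - τ(a) τ(b)| < ε` for all `a, b ∈ F`. -/
def IsWeaklyMixingAction {Γ : Type*} [Group Γ] (τ : M →ₗ[ℂ] ℂ) (α : Γ →* (M ≃⋆ₐ[ℂ] M)) : Prop :=
  ∀ F : Finset M, ∀ ε : ℝ, 0 < ε → ∃ g : Γ, ∀ a ∈ F, ∀ b ∈ F, ‖τ (α g a * b) - τ a * τ b‖ < ε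

/-- `E` is the `τ`-preserving conditional expectation of `M` onto `A`: `E(x) ∈ A` and
`τ(E(x) a) = τ(x a)` for all `x ∈ M` and `a ∈ A`. These conditions determine `E` uniquely
when `τ` is a faithful trace. -/
def IsConditionalExpectation (τ : M →ₗ[ℂ] ℂ) (A : StarSubalgebra ℂ M) (E : M → M) : Prop :=
  ∀ x : M, E x ∈ A ∧ ∀ a ∈ A, τ (E x * a) = τ (x * a)

/-- Relative weak mixing: an action `σ` of `G` on `M` (leaving `A` globally
invariant) is *weakly mixing relative to* `A` if for every finite set `F` in
`M ⊖ A = {x | E_A(x) = 0}` and every `ε > 0` there is `g` such that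
`‖E_A(x* σ_g(y))‖₂ ≤ ε` for all `x, y ∈ F`. -/
def IsWeaklyMixingRelativeTo {G : Type*} [Group G] (τ : M →ₗ[ℂ] ℂ) (A : StarSubalgebra ℂ M)
    (σ : G →* (M ≃⋆ₐ[ℂ] M)) : Prop :=
  (∀ g, ∀ x, σ g x ∈ A ↔ x ∈ A) ∧
  ∃ E : M → M, IsConditionalExpectation τ A E ∧
    ∀ F : Finset M, (∀ x ∈ F, E x = 0) → ∀ ε : ℝ, 0 < ε →
      ∃ g : G, ∀ x ∈ F, ∀ y ∈ F, twoNorm τ (E (star x * σ g y)) ≤ ε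

/-- `A` is *weakly mixing in* `M` if there is a subgroup `G` of the unitary group `U(A)` whose
action on `M` by conjugation `σ_v(x) = v x v*` is weakly mixing relative to `A`. -/
def IsWeaklyMixingIn (τ : M →ₗ[ℂ] ℂ) (A : StarSubalgebra ℂ M) : Prop :=
  ∃ G : Subgroup (unitary M), (∀ v ∈ G, (v : M) ∈ A) ∧
    IsWeaklyMixingRelativeTo τ A ((Unitary.conjStarAlgAut ℂ M).comp G.subtype)

end Mixing

/-! ### Von Neumann algebras -/

section VN

variable {H : Type*} [NormedAddCommGroup H] [InnerProductSpace ℂ H] [CompleteSpace H]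

/-- The von Neumann algebra generated by a set of operators: the bicommutant of
`S ∪ S*`. -/
def vonNeumannGenerated (S : Set (H →L[ℂ] H)) : VonNeumannAlgebra H where
  toStarSubalgebra := StarSubalgebra.centralizer ℂ (StarSubalgebra.centralizer ℂ S : Set (H →L[ℂ] H))
  centralizer_centralizer' := by
    change Set.centralizer (Set.centralizer ((StarSubalgebra.centralizer ℂ
      (StarSubalgebra.centralizer ℂ S : Set (H →L[ℂ] H)) : StarSubalgebra ℂ (H →L[ℂ] H)) :
        Set (H →L[ℂ] H))) = ((StarSubalgebra.centralizer ℂ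
      (StarSubalgebra.centralizer ℂ S : Set (H →L[ℂ] H)) : StarSubalgebra ℂ (H →L[ℂ] H)) :
        Set (H →L[ℂ] H))
    rw [StarSubalgebra.coe_centralizer_centralizer, Set.centralizer_centralizer_centralizer]

theorem coe_vonNeumannGenerated (S : Set (H →L[ℂ] H)) :
    ((vonNeumannGenerated S).toStarSubalgebra : Set (H →L[ℂ] H)) =
      (S ∪ star S).centralizer.centralizer :=
  StarSubalgebra.coe_centralizer_centralizer ℂ S

/-- A *trace* on the von Neumann algebra `B ⊆ B(H)` in the sense used here: a normal, faithful,
positive, tracial linear functional with `τ(1) = 1`. Normality is ultraweak continuity, i.e. `τ`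
has the form `x ↦ ∑ₙ ⟨x ξₙ, ηₙ⟩` with `∑ ‖ξₙ‖² < ∞` and `∑ ‖ηₙ‖² < ∞`. -/
structure IsNormalFaithfulTrace (B : VonNeumannAlgebra H) (τ : B.toStarSubalgebra →ₗ[ℂ] ℂ) :
    Prop where
  map_one : τ 1 = 1
  nonneg : ∀ x, 0 ≤ τ (star x * x)
  faithful : ∀ x, τ (star x * x) = 0 → x = 0
  tracial : ∀ x y, τ (x * y) = τ (y * x)
  normal : ∃ ξ η : ℕ → H, Summable (fun n => ‖ξ n‖ ^ 2) ∧ Summable (fun n => ‖η n‖ ^ 2) ∧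
    ∀ x : B.toStarSubalgebra, HasSum (fun n => inner ℂ (η n) ((x : H →L[ℂ] H) (ξ n))) (τ x)

/-- `*`-automorphisms of a von Neumann algebra are isometric. -/
theorem norm_aut_apply (B : VonNeumannAlgebra H)
    (φ : B.toStarSubalgebra ≃⋆ₐ[ℂ] B.toStarSubalgebra) (b : B.toStarSubalgebra) :
    ‖((φ b : B.toStarSubalgebra) : H →L[ℂ] H)‖ = ‖(b : H →L[ℂ] H)‖ := by
  have hc : IsClosed (B.toStarSubalgebra : Set (H →L[ℂ] H)) := by
    rw [VonNeumannAlgebra.coe_toStarSubalgebra, ← B.centralizer_centralizer]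
    exact Set.isClosed_centralizer _
  have : IsClosed (B.toStarSubalgebra : Set (H →L[ℂ] H)) := hc
  exact NonUnitalStarAlgHom.norm_map φ (EquivLike.injective φ) b

end VN

/-! ### The crossed product -/

section Crossed

/-- The Hilbert space `ℓ²(Γ, H) = ℓ²(Γ) ⊗ H`. -/
abbrev EllTwo (Γ H : Type*) [NormedAddCommGroup H] : Type _ := lp (fun _ : Γ => H) 2

variable {Γ : Type*} {H : Type*} [NormedAddCommGroup H]

theorem ellTwo_summable_sq (f : EllTwo Γ H) : Summable fun g => ‖f g‖ ^ 2 := by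
  have := (lp.memℓp f).summable (by norm_num)
  simpa using this

theorem ellTwo_mem {f : Γ → H} (hf : Summable fun g => ‖f g‖ ^ 2) : Memℓp f 2 :=
  memℓp_gen (by simpa using hf)

theorem ellTwo_norm_sq (f : EllTwo Γ H) : ‖f‖ ^ 2 = ∑' g, ‖f g‖ ^ 2 := by
  have := lp.norm_rpow_eq_tsum (p := 2) (by norm_num) f
  simpa using this

variable [InnerProductSpace ℂ H]

theorem summable_sq_diag (T : Γ → H →L[ℂ] H) (C : ℝ) (hC : ∀ g, ‖T g‖ ≤ C) (f : EllTwo Γ H) :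
    (∀ g, ‖T g (f g)‖ ^ 2 ≤ C ^ 2 * ‖f g‖ ^ 2) ∧ Summable fun g => ‖T g (f g)‖ ^ 2 := by
  have key : ∀ g, ‖T g (f g)‖ ^ 2 ≤ C ^ 2 * ‖f g‖ ^ 2 := fun g => by
    rw [← mul_pow]
    exact pow_le_pow_left₀ (norm_nonneg _) ((T g).le_of_opNorm_le (hC g) _) 2
  exact ⟨key, Summable.of_nonneg_of_le (fun _ => by positivity) key
    ((ellTwo_summable_sq f).mul_left (C ^ 2))⟩

/-- The diagonal operator `(T ξ)(g) = T_g (ξ(g))` attached to a uniformly bounded family. -/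
def diagOp (T : Γ → H →L[ℂ] H) (C : ℝ) (hC : ∀ g, ‖T g‖ ≤ C) : EllTwo Γ H →L[ℂ] EllTwo Γ H :=
  LinearMap.mkContinuous
    { toFun := fun f => ⟨fun g => T g (f g), ellTwo_mem (summable_sq_diag T C hC f).2⟩
      map_add' := fun f₁ f₂ => lp.ext (funext fun g => map_add (T g) (f₁ g) (f₂ g))
      map_smul' := fun c f => lp.ext (funext fun g => map_smul (T g) c (f g)) }
    |C| (fun f => by
      refine (sq_le_sq₀ (norm_nonneg _) (by positivity)).mp ?_
      rw [mul_pow, sq_abs, ellTwo_norm_sq, ellTwo_norm_sq, ← tsum_mul_left]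
      exact (summable_sq_diag T C hC f).2.tsum_le_tsum (summable_sq_diag T C hC f).1
        ((ellTwo_summable_sq f).mul_left (C ^ 2)))

@[simp]
theorem diagOp_apply (T : Γ → H →L[ℂ] H) (C : ℝ) (hC : ∀ g, ‖T g‖ ≤ C) (f : EllTwo Γ H) (g : Γ) :
    diagOp T C hC f g = T g (f g) := rfl

theorem summable_sq_translation [Group Γ] (h : Γ) (f : EllTwo Γ H) :
    Summable fun g => ‖f (h⁻¹ * g)‖ ^ 2 :=
  (Equiv.mulLeft h⁻¹).summable_iff (f := fun g => ‖f g‖ ^ 2) |>.mpr (ellTwo_summable_sq f)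

/-- The translation operator `(λ(h) ξ)(g) = ξ(h⁻¹ g)` on `ℓ²(Γ, H)`. -/
def translation [Group Γ] (h : Γ) : EllTwo Γ H →L[ℂ] EllTwo Γ H :=
  LinearMap.mkContinuous
    { toFun := fun f => ⟨fun g => f (h⁻¹ * g), ellTwo_mem (summable_sq_translation h f)⟩
      map_add' := fun _ _ => rfl
      map_smul' := fun _ _ => rfl }
    1 (fun f => by
      refine (sq_le_sq₀ (norm_nonneg _) (by positivity)).mp ?_
      rw [one_mul, ellTwo_norm_sq, ellTwo_norm_sq]
      exact ((Equiv.mulLeft h⁻¹).tsum_eq (fun g => ‖f g‖ ^ 2)).le)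

@[simp]
theorem translation_apply [Group Γ] (h : Γ) (f : EllTwo Γ H) (g : Γ) :
    translation h f g = f (h⁻¹ * g) := rfl

variable [CompleteSpace H]

theorem star_diagOp_const (b : H →L[ℂ] H) :
    star (diagOp (fun _ : Γ => b) ‖b‖ (fun _ => le_rfl)) =
      diagOp (fun _ : Γ => star b) ‖star b‖ (fun _ => le_rfl) := by
  symm
  refine (ContinuousLinearMap.eq_adjoint_iff _ _).mpr fun f f' => ?_
  simp [lp.inner_eq_tsum, ContinuousLinearMap.star_eq_adjoint,
    ContinuousLinearMap.adjoint_inner_left]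

variable [Group Γ]

/-- The representation `(π(b) ξ)(g) = α_{g⁻¹}(b) ξ(g)` of `B` on `ℓ²(Γ, H)`. -/
def crossedRep (B : VonNeumannAlgebra H)
    (α : Γ →* (B.toStarSubalgebra ≃⋆ₐ[ℂ] B.toStarSubalgebra)) (b : B.toStarSubalgebra) :
    EllTwo Γ H →L[ℂ] EllTwo Γ H :=
  diagOp (fun g => ((α g⁻¹ b : B.toStarSubalgebra) : H →L[ℂ] H)) ‖(b : H →L[ℂ] H)‖
    (fun _ => (norm_aut_apply B _ b).le)

/-- The crossed product `B ⋊_α Γ`: the von Neumann algebra on `ℓ²(Γ, H)` generated by `π(B)`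
and `λ(Γ)`. -/
def crossedProduct (B : VonNeumannAlgebra H)
    (α : Γ →* (B.toStarSubalgebra ≃⋆ₐ[ℂ] B.toStarSubalgebra)) : VonNeumannAlgebra (EllTwo Γ H) :=
  vonNeumannGenerated (Set.range (crossedRep B α) ∪ Set.range translation)

/-- The subalgebra `L(Γ)` of the crossed product: the von Neumann algebra generated by `λ(Γ)`,
seen as a subalgebra of `B ⋊_α Γ`. -/
def crossedGroupAlgebra (B : VonNeumannAlgebra H)
    (α : Γ →* (B.toStarSubalgebra ≃⋆ₐ[ℂ] B.toStarSubalgebra)) :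
    StarSubalgebra ℂ (crossedProduct B α).toStarSubalgebra :=
  (vonNeumannGenerated
    (Set.range (translation : Γ → EllTwo Γ H →L[ℂ] EllTwo Γ H))).toStarSubalgebra.comap
      (crossedProduct B α).toStarSubalgebra.subtype

open Classical in
/-- The corner `V* x V` of an operator `x` on `ℓ²(Γ, H)`, where `V : H → ℓ²(Γ, H)`
maps `ξ` to the function equal to `ξ` at `1` and to `0` elsewhere. -/
def unitCorner : (EllTwo Γ H →L[ℂ] EllTwo Γ H) →ₗ[ℂ] (H →L[ℂ] H) where
  toFun x := ContinuousLinearMap.adjoint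
      (lp.singleContinuousLinearMap ℂ (fun _ : Γ => H) 2 (1 : Γ)) ∘L x ∘L
      lp.singleContinuousLinearMap ℂ (fun _ : Γ => H) 2 (1 : Γ)
  map_add' x y := by ext; simp
  map_smul' c x := by ext; simp

open Classical in
theorem unitCorner_apply (x : EllTwo Γ H →L[ℂ] EllTwo Γ H) (ξ : H) :
    unitCorner x ξ = x (lp.single 2 (1 : Γ) ξ) 1 := by
  refine ext_inner_left ℂ fun v => ?_
  simp [unitCorner, ContinuousLinearMap.adjoint_inner_right, lp.inner_single_left]

theorem unitCorner_mem (B : VonNeumannAlgebra H)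
    (α : Γ →* (B.toStarSubalgebra ≃⋆ₐ[ℂ] B.toStarSubalgebra))
    {x : EllTwo Γ H →L[ℂ] EllTwo Γ H} (hx : x ∈ (crossedProduct B α).toStarSubalgebra) :
    unitCorner x ∈ B.toStarSubalgebra := by
  classical
  -- `1 ⊗ b'` commutes with the generators for every `b'` in the commutant of `B`
  have hcomm : ∀ b' ∈ B.commutant, ∀ s ∈ Set.range (crossedRep B α) ∪ Set.range translation,
      s * diagOp (fun _ : Γ => b') ‖b'‖ (fun _ => le_rfl) =
        diagOp (fun _ : Γ => b') ‖b'‖ (fun _ => le_rfl) * s := by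
    rintro b' hb' s (⟨b, rfl⟩ | ⟨h, rfl⟩)
    · ext f g
      have := VonNeumannAlgebra.mem_commutant_iff.mp hb' _ (α g⁻¹ b).2
      exact congrArg (fun T : H →L[ℂ] H => T (f g)) this
    · ext f g
      rfl
  have hmem : ∀ b' ∈ B.commutant, diagOp (fun _ : Γ => b') ‖b'‖ (fun _ => le_rfl) ∈
      ((Set.range (crossedRep B α) ∪ Set.range translation) ∪
        star (Set.range (crossedRep B α) ∪ Set.range translation)).centralizer := by
    intro b' hb' s hs
    rcases hs with hs | hs
    · exact hcomm b' hb' s hs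
    · have h := congrArg star (hcomm (star b') (star_mem hb') (star s) hs)
      rw [star_mul, star_mul, star_star, star_diagOp_const] at h
      simp only [star_star] at h
      exact h.symm
  have hx' : x ∈ ((Set.range (crossedRep B α) ∪ Set.range translation) ∪
        star (Set.range (crossedRep B α) ∪ Set.range translation)).centralizer.centralizer := by
    rw [← coe_vonNeumannGenerated]; exact hx
  have hB : unitCorner x ∈ B.commutant.commutant := by
    rw [VonNeumannAlgebra.mem_commutant_iff]
    intro b' hb'
    have hc := hx' _ (hmem b' hb')
    ext ξ
    have hs : diagOp (fun _ : Γ => b') ‖b'‖ (fun _ => le_rfl) (lp.single 2 (1 : Γ) ξ) =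
        lp.single 2 (1 : Γ) (b' ξ) := by
      ext g
      by_cases hg : g = 1
      · subst hg; simp
      · simp [Pi.single_eq_of_ne hg]
    have h1 := congrArg (fun T : EllTwo Γ H →L[ℂ] EllTwo Γ H => T (lp.single 2 (1 : Γ) ξ) 1) hc
    simp only [mul_apply_eq_comp, diagOp_apply, hs] at h1
    simpa [unitCorner_apply] using h1
  rwa [VonNeumannAlgebra.commutant_commutant] at hB

/-- The trace on the crossed product extending the trace `τ` of `B`: `x ↦ τ(V* x V)`, so that
`∑ π(b_g) λ(g) ↦ τ(b_1)`. -/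
def crossedTrace (B : VonNeumannAlgebra H)
    (α : Γ →* (B.toStarSubalgebra ≃⋆ₐ[ℂ] B.toStarSubalgebra))
    (τ : B.toStarSubalgebra →ₗ[ℂ] ℂ) : (crossedProduct B α).toStarSubalgebra →ₗ[ℂ] ℂ where
  toFun x := τ ⟨unitCorner (x : EllTwo Γ H →L[ℂ] EllTwo Γ H), unitCorner_mem B α x.2⟩
  map_add' x y := by
    rw [← map_add]
    exact congrArg τ (Subtype.ext (map_add unitCorner _ _))
  map_smul' c x := by
    rw [RingHom.id_apply, ← map_smul]
    exact congrArg τ (Subtype.ext (map_smul unitCorner c _))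

end Crossed

end

/-! For `v ∈ U(A)` put `v_g = τ(λ(g)* v)`. If `a, b ∈ B`, then `E_A(π(b) v π(a) v*) v` has Fourier
coefficients `v_g τ(b α_g(a))` (`coefficient_expectation`), so its squared 2-norm is `∑ |v_g|² |τ(b
α_g(a))|²`. Since `∑ |v_g|² = 1`, this is an average of squared correlations over the group. If it
is small for all pairs from a finite set of trace-zero elements, one `g` must make all these
correlations small: (1) implies (2).

Conversely take `G = λ(Γ₀)`. As `Γ₀` is abelian, conjugation by `λ(p)` fixes each `λ(k)`, and the
expectation of a product of monomials is a correlation `τ(α_p(c') b')` times a unitary, with `τ(c')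
= 0`. It tends to zero along a mixing net, and 2-norm approximation by finite Fourier sums extends
this to every `x, y` with zero expectation (`tendsto_twoNormSq_expectation`).

Both arguments use only the identities collected in `IsCrossedSystem`. Verifying these for the
crossed product rests on one density principle: normal functionals that agree on a multiplicative
`*`-closed set containing 1 agree on its bicommutant
(`inner_amp_eq_of_mem_centralizer_centralizer`). It gives traciality, scalarity of the corner on
`A`, and existence of `E_A` as a slice map `id ⊗ τ`. -/

noncomputable section

/-! ### Coordinate embeddings into `ℓ²(Γ, H)`. -/

section Delta

variable {Γ : Type*} {H : Type*} [NormedAddCommGroup H] [InnerProductSpace ℂ H]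

open Classical in
/-- The isometry `H → ℓ²(Γ, H)` onto the functions supported at `g`. -/
def delta (g : Γ) : H →L[ℂ] EllTwo Γ H :=
  lp.singleContinuousLinearMap ℂ (fun _ : Γ => H) 2 g

open Classical in
theorem delta_apply (g : Γ) (ξ : H) (h : Γ) : delta g ξ h = if h = g then ξ else 0 := by
  simp [delta, Pi.single_apply]

theorem norm_delta (g : Γ) (ξ : H) : ‖delta g ξ‖ = ‖ξ‖ := by
  classical
  simp [delta]

theorem inner_delta_left (g : Γ) (ξ : H) (f : EllTwo Γ H) :
    inner ℂ (delta g ξ) f = inner ℂ ξ (f g) := by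
  classical
  simpa [delta] using lp.inner_single_left g ξ f

theorem adjoint_delta_apply [CompleteSpace H] (g : Γ) (f : EllTwo Γ H) :
    (delta (H := H) g).adjoint f = f g := by
  refine ext_inner_left ℂ fun u => ?_
  rw [ContinuousLinearMap.adjoint_inner_right, inner_delta_left]

theorem continuousLinearMap_ext_delta {F : Type*} [NormedAddCommGroup F] [NormedSpace ℂ F]
    {S T : EllTwo Γ H →L[ℂ] F} (h : ∀ g ξ, S (delta g ξ) = T (delta g ξ)) : S = T := by
  classical
  ext f
  have hf := lp.hasSum_single (p := 2) (by norm_num) f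
  have h1 := hf.mapL S
  have h2 := hf.mapL T
  refine h1.unique (h2.congr_fun fun g => ?_)
  simpa [delta] using h g (f g)

end Delta

/-! ### Amplifications and the density principle for normal functionals. -/

section Amplification

variable {K : Type*} [NormedAddCommGroup K] [InnerProductSpace ℂ K] {ι κ : Type*}

/-- The amplification `x ↦ 1 ⊗ x` of operators to `ℓ²(ι, K)`. -/
def amp (ι : Type*) (x : K →L[ℂ] K) : EllTwo ι K →L[ℂ] EllTwo ι K :=
  diagOp (fun _ => x) ‖x‖ fun _ => le_rfl

@[simp]
theorem amp_apply (x : K →L[ℂ] K) (f : EllTwo ι K) (i : ι) : amp ι x f i = x (f i) := rfl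

theorem amp_delta (x : K →L[ℂ] K) (i : ι) (v : K) : amp ι x (delta i v) = delta i (x v) := by
  ext j
  simp only [amp_apply, delta_apply]
  split_ifs <;> simp

/-- This turns a normal functional into a single vector functional of the amplification, the form in
which normality is used below. -/
theorem hasSum_inner_amp (η ξ : EllTwo ι K) (x : K →L[ℂ] K) :
    HasSum (fun i => inner ℂ (η i) (x (ξ i))) (inner ℂ η (amp ι x ξ)) :=
  lp.hasSum_inner η (amp ι x ξ)

variable [CompleteSpace K]

theorem amp_star (x : K →L[ℂ] K) : amp ι (star x) = star (amp ι x) :=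
  (star_diagOp_const x).symm

theorem inner_amp_left (x : K →L[ℂ] K) (f f' : EllTwo ι K) :
    inner ℂ (amp ι x f) f' = inner ℂ f (amp ι (star x) f') := by
  rw [amp_star, ContinuousLinearMap.star_eq_adjoint, ContinuousLinearMap.adjoint_inner_right]

/-- The double commutant of a set of operators closed under products and adjoints acts on
`ℓ²(ι, K)` inside the closed cyclic subspaces of that set. -/
theorem inner_amp_eq_zero_of_mem_centralizer_centralizer {S : Set (K →L[ℂ] K)} (h1 : 1 ∈ S)
    (hmul : ∀ s ∈ S, ∀ t ∈ S, s * t ∈ S) (hstar : ∀ s ∈ S, star s ∈ S) {η ξ : EllTwo ι K}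
    (h : ∀ s ∈ S, inner ℂ η (amp ι s ξ) = 0) {z : K →L[ℂ] K}
    (hz : z ∈ S.centralizer.centralizer) : inner ℂ η (amp ι z ξ) = 0 := by
  set N : Submodule ℂ (EllTwo ι K) :=
    (Submodule.span ℂ ((fun s => amp ι s ξ) '' S)).topologicalClosure with hN
  have hNc : IsClosed (N : Set (EllTwo ι K)) := Submodule.isClosed_topologicalClosure _
  have : CompleteSpace N := hNc.completeSpace_coe
  have hsub : ∀ s ∈ S, amp ι s ξ ∈ N := fun s hs =>
    Submodule.le_topologicalClosure _ (Submodule.subset_span ⟨s, hs, rfl⟩)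
  have hinv : ∀ s ∈ S, ∀ f ∈ N, amp ι s f ∈ N := by
    intro s hs
    have : N ≤ N.comap (amp ι s).toLinearMap := by
      refine Submodule.topologicalClosure_minimal _ (Submodule.span_le.mpr ?_)
        (hNc.preimage (amp ι s).continuous)
      rintro _ ⟨t, ht, rfl⟩
      exact hsub (s * t) (hmul s hs t ht)
    exact this
  -- `N` is invariant under `S` and under adjoints from `S`, hence reducing.
  have hcomm : ∀ s ∈ S, ∀ f, N.starProjection (amp ι s f) = amp ι s (N.starProjection f) := by
    intro s hs f
    refine (Submodule.eq_starProjection_of_mem_of_inner_eq_zero (u := amp ι s f)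
      (hinv s hs _ (N.starProjection_apply_mem f)) fun w hw => ?_)
    rw [← map_sub, inner_amp_left]
    exact N.starProjection_inner_eq_zero f _ (hinv _ (hstar s hs) w hw)
  -- The matrix entries of the projection onto `N` lie in the commutant of `S`, so they commute with
  -- `z`; comparing entries, the projection commutes with `1 ⊗ z`.
  have hentry : ∀ i j, ((delta (H := K) i).adjoint ∘L N.starProjection ∘L delta (H := K) j) ∈
      S.centralizer := by
    intro i j s hs
    ext v
    simp only [mul_apply_eq_comp, ContinuousLinearMap.comp_apply, adjoint_delta_apply]
    rw [← amp_delta, hcomm s hs, amp_apply]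
  have hz' : ∀ f, N.starProjection (amp ι z f) = amp ι z (N.starProjection f) := by
    have : N.starProjection ∘L amp ι z = amp ι z ∘L N.starProjection := by
      refine continuousLinearMap_ext_delta fun j v => lp.ext (funext fun i => ?_)
      have := congrArg (fun T : K →L[ℂ] K => T v) (hz _ (hentry i j))
      simp only [mul_apply_eq_comp, ContinuousLinearMap.comp_apply, adjoint_delta_apply] at this
      rw [ContinuousLinearMap.comp_apply, ContinuousLinearMap.comp_apply, amp_delta, amp_apply]
      exact this
    intro f
    exact congrArg (fun T : EllTwo ι K →L[ℂ] EllTwo ι K => T f) this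
  have hξ : N.starProjection ξ = ξ :=
    N.starProjection_eq_self_iff.mpr (hsub 1 h1)
  have hmem : amp ι z ξ ∈ N := by
    rw [← N.starProjection_eq_self_iff, hz', hξ]
  have hle : N ≤ (innerSL ℂ η).toLinearMap.ker := by
    refine Submodule.topologicalClosure_minimal _ (Submodule.span_le.mpr ?_)
      (ContinuousLinearMap.isClosed_ker (innerSL ℂ η))
    rintro _ ⟨s, hs, rfl⟩
    simpa using h s hs
  simpa using hle hmem

/-- Two normal functionals which agree on a set of operators closed under products and adjoints
agree on its double commutant. -/
theorem inner_amp_eq_of_mem_centralizer_centralizer {S : Set (K →L[ℂ] K)} (h1 : 1 ∈ S)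
    (hmul : ∀ s ∈ S, ∀ t ∈ S, s * t ∈ S) (hstar : ∀ s ∈ S, star s ∈ S) {η ξ : EllTwo ι K}
    {η' ξ' : EllTwo κ K} (h : ∀ s ∈ S, inner ℂ η (amp ι s ξ) = inner ℂ η' (amp κ s ξ'))
    {z : K →L[ℂ] K} (hz : z ∈ S.centralizer.centralizer) :
    inner ℂ η (amp ι z ξ) = inner ℂ η' (amp κ z ξ') := by
  -- The difference of the two functionals is again a vector functional, with the vectors `(η, -η')`
  -- and `(ξ, ξ')` over `ι ⊕ κ`.
  have hs : ∀ (f : EllTwo ι K) (f' : EllTwo κ K),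
      Summable fun i => ‖(Sum.elim f f' : ι ⊕ κ → K) i‖ ^ 2 := fun f f' =>
    Summable.sum _ (ellTwo_summable_sq f) (ellTwo_summable_sq f')
  have key : ∀ x : K →L[ℂ] K,
      inner ℂ (⟨_, ellTwo_mem (hs η (-η'))⟩ : EllTwo (ι ⊕ κ) K)
        (amp (ι ⊕ κ) x ⟨_, ellTwo_mem (hs ξ ξ')⟩) =
      inner ℂ η (amp ι x ξ) - inner ℂ η' (amp κ x ξ') := by
    intro x
    refine (hasSum_inner_amp _ _ x).unique ?_
    rw [sub_eq_add_neg, ← inner_neg_left]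
    exact HasSum.sum (hasSum_inner_amp η ξ x) (hasSum_inner_amp (-η') ξ' x)
  have := inner_amp_eq_zero_of_mem_centralizer_centralizer h1 hmul hstar
    (fun s hs => (key s).trans (sub_eq_zero.mpr (h s hs))) hz
  exact sub_eq_zero.mp ((key z).symm.trans this)

end Amplification

end

noncomputable section

/-! ### Slice maps of normal functionals. -/

section Slice

variable {Γ I κ : Type*} {H : Type*} [NormedAddCommGroup H] [InnerProductSpace ℂ H]

theorem HilbertBasis.hasSum_norm_inner_sq (e : HilbertBasis I ℂ H) (v : H) :
    HasSum (fun i => ‖inner ℂ (e i) v‖ ^ 2) (‖v‖ ^ 2) := by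
  have h := (ellTwo_summable_sq (e.repr v)).hasSum
  rw [← ellTwo_norm_sq, LinearIsometryEquiv.norm_map] at h
  simpa [HilbertBasis.repr_apply_apply] using h

theorem norm_amp_rankOne_sq (v u : H) (f : EllTwo Γ H) :
    ‖amp Γ (InnerProductSpace.rankOne ℂ v u) f‖ ^ 2 =
      (∑' g, ‖inner ℂ u (f g)‖ ^ 2) * ‖v‖ ^ 2 := by
  rw [ellTwo_norm_sq, ← tsum_mul_right]
  simp [norm_smul, mul_pow]

/-- Parseval for `e` at each point of `Γ`, times `∑ ‖ξ n‖²`. It makes the slice map well defined and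
bounded by `‖ξ‖`. -/
theorem hasSum_norm_amp_rankOne_sq (e : HilbertBasis I ℂ H) (ξ : EllTwo κ H) (f : EllTwo Γ H) :
    HasSum (fun p : I × κ => ‖amp Γ (InnerProductSpace.rankOne ℂ (ξ p.2) (e p.1)) f‖ ^ 2)
      (‖f‖ ^ 2 * ‖ξ‖ ^ 2) := by
  have h1 : ∀ g, HasSum (fun i => ‖inner ℂ (e i) (f g)‖ ^ 2) (‖f g‖ ^ 2) :=
    fun g => e.hasSum_norm_inner_sq (f g)
  have h2 : Summable fun p : Γ × I => ‖inner ℂ (e p.2) (f p.1)‖ ^ 2 := by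
    refine (summable_prod_of_nonneg fun p => by positivity).mpr ⟨fun g => (h1 g).summable, ?_⟩
    simpa only [fun g => (h1 g).tsum_eq] using ellTwo_summable_sq f
  have h3 : HasSum (fun p : Γ × I => ‖inner ℂ (e p.2) (f p.1)‖ ^ 2) (‖f‖ ^ 2) := by
    rw [ellTwo_norm_sq, ← tsum_congr fun g => (h1 g).tsum_eq,
      ← h2.tsum_prod' fun g => (h1 g).summable]
    exact h2.hasSum
  have h4 : HasSum (fun p : I × Γ => ‖inner ℂ (e p.1) (f p.2)‖ ^ 2) (‖f‖ ^ 2) :=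
    (Equiv.prodComm I Γ).hasSum_iff.mpr h3
  have h5 : HasSum (fun i => ∑' g, ‖inner ℂ (e i) (f g)‖ ^ 2) (‖f‖ ^ 2) :=
    h4.prod_fiberwise fun i => (h4.summable.prod_factor i).hasSum
  have h6 : HasSum (fun n => ‖ξ n‖ ^ 2) (‖ξ‖ ^ 2) := by
    rw [ellTwo_norm_sq]
    exact (ellTwo_summable_sq ξ).hasSum
  have h7 := h5.mul h6 (h5.summable.mul_of_nonneg h6.summable
    (fun i => tsum_nonneg fun g => sq_nonneg _) fun n => sq_nonneg _)
  exact h7.congr_fun fun p => norm_amp_rankOne_sq (ξ p.2) (e p.1) f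

/-- The operator `ℓ²(Γ, H) → ℓ²(I × κ, ℓ²(Γ, H))` with components `1 ⊗ |ξₙ⟩⟨eᵢ|`. -/
def sliceMap (Γ : Type*) (e : HilbertBasis I ℂ H) (ξ : EllTwo κ H) :
    EllTwo Γ H →L[ℂ] EllTwo (I × κ) (EllTwo Γ H) :=
  LinearMap.mkContinuous
    { toFun := fun f => ⟨fun p => amp Γ (InnerProductSpace.rankOne ℂ (ξ p.2) (e p.1)) f,
        ellTwo_mem (hasSum_norm_amp_rankOne_sq e ξ f).summable⟩
      map_add' := fun f₁ f₂ => lp.ext (funext fun _ => map_add _ f₁ f₂)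
      map_smul' := fun c f => lp.ext (funext fun _ => map_smul _ c f) }
    ‖ξ‖ (fun f => by
      refine (sq_le_sq₀ (norm_nonneg _) (by positivity)).mp ?_
      rw [ellTwo_norm_sq, mul_pow, mul_comm]
      exact (hasSum_norm_amp_rankOne_sq e ξ f).tsum_eq.le)

theorem sliceMap_apply (e : HilbertBasis I ℂ H) (ξ : EllTwo κ H) (f : EllTwo Γ H) (p : I × κ) :
    sliceMap Γ e ξ f p = amp Γ (InnerProductSpace.rankOne ℂ (ξ p.2) (e p.1)) f := rfl

theorem sliceMap_delta_apply (e : HilbertBasis I ℂ H) (ξ : EllTwo κ H) (g : Γ) (v : H)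
    (p : I × κ) : sliceMap Γ e ξ (delta g v) p = inner ℂ (e p.1) v • delta g (ξ p.2) := by
  rw [sliceMap_apply, amp_delta, InnerProductSpace.rankOne_apply, map_smul]

variable [CompleteSpace H]

/-- The slice map `(id ⊗ ω) ⊗ 1`, where `ω` is the normal functional `∑ ⟨· ξₙ, ηₙ⟩` on `B(H)`. -/
def sliceOp (e : HilbertBasis I ℂ H) (η ξ : EllTwo κ H) (x : EllTwo Γ H →L[ℂ] EllTwo Γ H) :
    EllTwo Γ H →L[ℂ] EllTwo Γ H :=
  (sliceMap Γ e η).adjoint ∘L amp (I × κ) x ∘L sliceMap Γ e ξ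

theorem inner_sliceOp (e : HilbertBasis I ℂ H) (η ξ : EllTwo κ H)
    (x : EllTwo Γ H →L[ℂ] EllTwo Γ H) (f f' : EllTwo Γ H) :
    inner ℂ f (sliceOp e η ξ x f') =
      inner ℂ (sliceMap Γ e η f) (amp (I × κ) x (sliceMap Γ e ξ f')) := by
  simp [sliceOp, ContinuousLinearMap.adjoint_inner_right]

/-- Slicing replaces each `B(H)`-valued matrix entry of `x` by its scalar value under `ω`: the
double sum factors, and its sum over the basis is `⟨u, w⟩`. -/
theorem sliceOp_delta_apply (e : HilbertBasis I ℂ H) (η ξ : EllTwo κ H)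
    (x : EllTwo Γ H →L[ℂ] EllTwo Γ H) (k h : Γ) (w : H) {c : ℂ}
    (hc : HasSum (fun n => inner ℂ (η n) (x (delta h (ξ n)) k)) c) :
    sliceOp e η ξ x (delta h w) k = c • w := by
  refine ext_inner_left ℂ fun u => ?_
  rw [← inner_delta_left, inner_sliceOp, inner_smul_right, mul_comm]
  have h1 := hasSum_inner_amp (sliceMap Γ e η (delta k u)) (sliceMap Γ e ξ (delta h w)) x
  have h2 : ∀ p : I × κ, inner ℂ (sliceMap Γ e η (delta k u) p)
      (x (sliceMap Γ e ξ (delta h w) p)) =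
      (inner ℂ u (e p.1) * inner ℂ (e p.1) w) * inner ℂ (η p.2) (x (delta h (ξ p.2)) k) := by
    intro p
    rw [sliceMap_delta_apply, sliceMap_delta_apply, map_smul, inner_smul_left, inner_smul_right,
      inner_delta_left, inner_conj_symm]
    ring
  have h3 := h1.congr_fun fun p => (h2 p).symm
  have h4 := (e.hasSum_inner_mul_inner u w).mul hc h3.summable
  exact h3.unique h4

end Slice

end

noncomputable section

/-! ### The 2-norm of a positive tracial functional. -/

section TraceNorm

open Filter Topology

variable {M : Type*} [Ring M] [StarRing M] [Algebra ℂ M] {T : M →ₗ[ℂ] ℂ}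

/-- Polarization: reality at `1 + x` compares imaginary parts, and reality at `1 + i x` compares
real parts. -/
theorem LinearMap.map_star_of_nonneg [StarModule ℂ M] (hT : ∀ x, 0 ≤ T (star x * x)) (x : M) :
    T (star x) = star (T x) := by
  have h1 := (Complex.nonneg_iff.mp (hT (1 + x))).2
  have h2 := (Complex.nonneg_iff.mp (hT (1 + Complex.I • x))).2
  have h3 := (Complex.nonneg_iff.mp (hT 1)).2
  have h4 := (Complex.nonneg_iff.mp (hT x)).2
  simp only [star_add, star_one, star_smul, add_mul, mul_add, one_mul, mul_one, map_add, map_smul,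
    smul_mul_assoc, mul_smul_comm, smul_eq_mul, Complex.add_im, Complex.mul_im, Complex.I_re,
    Complex.I_im, Complex.star_def, Complex.conj_re, Complex.conj_im, Complex.mul_re] at h1 h2 h3 h4
  refine Complex.ext ?_ ?_ <;> simp <;> linarith

/-- The square `τ(x* x)` of the norm `‖x‖₂`. -/
def twoNormSq (T : M →ₗ[ℂ] ℂ) (x : M) : ℝ := (T (star x * x)).re

theorem twoNormSq_nonneg (hT : ∀ x, 0 ≤ T (star x * x)) (x : M) : 0 ≤ twoNormSq T x :=
  (Complex.nonneg_iff.mp (hT x)).1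

theorem twoNorm_le_iff {ε : ℝ} (hε : 0 ≤ ε) (x : M) :
    twoNorm T x ≤ ε ↔ twoNormSq T x ≤ ε ^ 2 := Real.sqrt_le_left hε

/-- The parallelogram identity with the term for `x - y` dropped. -/
theorem twoNormSq_add_le (hT : ∀ x, 0 ≤ T (star x * x)) (x y : M) :
    twoNormSq T (x + y) ≤ 2 * twoNormSq T x + 2 * twoNormSq T y := by
  have h := twoNormSq_nonneg hT (x - y)
  simp only [twoNormSq, star_add, star_sub, add_mul, mul_add, sub_mul, mul_sub, map_add, map_sub,
    Complex.add_re, Complex.sub_re] at h ⊢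
  linarith

theorem twoNormSq_smul [StarModule ℂ M] (c : ℂ) (x : M) : twoNormSq T (c • x) = ‖c‖ ^ 2 * twoNormSq T x := by
  simp only [twoNormSq, star_smul, smul_mul_assoc, mul_smul_comm, map_smul, smul_eq_mul]
  rw [← mul_assoc, Complex.star_def, Complex.mul_conj', ← Complex.ofReal_pow, Complex.re_ofReal_mul]

theorem twoNormSq_unitary_mul (v : unitary M) (x : M) :
    twoNormSq T (v * x) = twoNormSq T x := by
  simp only [twoNormSq, star_mul]
  rw [mul_assoc, ← mul_assoc (star (v : M)), Unitary.coe_star_mul_self, one_mul]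

theorem twoNormSq_star (hT : ∀ x y, T (x * y) = T (y * x)) (x : M) :
    twoNormSq T (star x) = twoNormSq T x := by
  simp only [twoNormSq, star_star, hT x]

theorem twoNormSq_mul_unitary (hT : ∀ x y, T (x * y) = T (y * x)) (v : unitary M) (x : M) :
    twoNormSq T (x * v) = twoNormSq T x := by
  rw [← twoNormSq_star hT, star_mul, ← Unitary.coe_star, twoNormSq_unitary_mul, twoNormSq_star hT]

theorem tendsto_twoNormSq_add (hT : ∀ x, 0 ≤ T (star x * x)) {ι : Type*} {l : Filter ι}
    {f g : ι → M} (hf : Tendsto (fun i => twoNormSq T (f i)) l (𝓝 0))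
    (hg : Tendsto (fun i => twoNormSq T (g i)) l (𝓝 0)) :
    Tendsto (fun i => twoNormSq T (f i + g i)) l (𝓝 0) := by
  refine squeeze_zero (fun i => twoNormSq_nonneg hT _) (fun i => twoNormSq_add_le hT _ _) ?_
  simpa using (hf.const_mul 2).add (hg.const_mul 2)

theorem tendsto_twoNormSq_sum (hT : ∀ x, 0 ≤ T (star x * x)) {ι κ : Type*} {l : Filter ι}
    (s : Finset κ) {f : κ → ι → M}
    (hf : ∀ k ∈ s, Tendsto (fun i => twoNormSq T (f k i)) l (𝓝 0)) :
    Tendsto (fun i => twoNormSq T (∑ k ∈ s, f k i)) l (𝓝 0) := by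
  classical
  induction s using Finset.induction_on with
  | empty => simpa [twoNormSq] using tendsto_const_nhds
  | insert a s ha ih =>
    simp only [Finset.sum_insert ha]
    exact tendsto_twoNormSq_add hT (hf a (Finset.mem_insert_self a s))
      (ih fun k hk => hf k (Finset.mem_insert_of_mem hk))

end TraceNorm

/-! ### Abstract crossed systems; from mixing of the subalgebra to mixing of the action. -/

theorem Unitary.star_coe_map {M Γ : Type*} [Ring M] [StarRing M] [Group Γ] (u : Γ →* unitary M) (g : Γ) :
    star (u g : M) = (u g⁻¹ : M) := by
  rw [map_inv, ← Unitary.coe_star, Unitary.star_eq_inv]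

/-- The algebraic properties of the crossed product `M` of `N` by an action `α` of `Γ` which are
used to compare weak mixing of `α` with weak mixing of the group algebra `A ⊆ M`: here `π` and `u`
are the embeddings of `N` and `Γ`, and `e` is the conditional expectation of `M` onto `N`. -/
structure IsCrossedSystem {M N Γ : Type*} [Ring M] [StarRing M] [Algebra ℂ M] [StarModule ℂ M]
    [Ring N] [StarRing N] [Algebra ℂ N] [StarModule ℂ N] [Group Γ]
    (τ : N →ₗ[ℂ] ℂ) (α : Γ →* (N ≃⋆ₐ[ℂ] N)) (T : M →ₗ[ℂ] ℂ) (A : StarSubalgebra ℂ M)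
    (π : N →⋆ₐ[ℂ] M) (u : Γ →* unitary M) (e : M →ₗ[ℂ] N) : Prop where
  map_one : τ 1 = 1
  tracial_base : ∀ a b, τ (a * b) = τ (b * a)
  invariant : PreservesTrace τ α
  trace_eq : ∀ x, T x = τ (e x)
  nonneg : ∀ x, 0 ≤ T (star x * x)
  faithful : ∀ x, T (star x * x) = 0 → x = 0
  tracial : ∀ x y, T (x * y) = T (y * x)
  map_rep_mul : ∀ b x, e (π b * x) = b * e x
  map_mul_rep : ∀ b x, e (x * π b) = e x * b
  map_unitary : ∀ g, g ≠ 1 → e (u g) = 0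
  covariant : ∀ g b, (u g : M) * π b = π (α g b) * u g
  parseval : ∀ x, HasSum (fun g => τ (star (e (star (u g : M) * x)) * e (star (u g : M) * x)))
    (T (star x * x))
  unitary_mem : ∀ g, (u g : M) ∈ A
  map_eq_smul_one : ∀ a ∈ A, e a = T a • (1 : N)
  map_one' : e 1 = 1
  bounded : ∀ x, ∃ C : ℝ, 0 < C ∧ ∀ y, twoNormSq T (x * y) ≤ C * twoNormSq T y
  exists_conditionalExpectation : ∃ E, IsConditionalExpectation T A E

namespace IsCrossedSystem

open Filter Topology

variable {M N Γ : Type*} [Ring M] [StarRing M] [Algebra ℂ M] [StarModule ℂ M]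
  [Ring N] [StarRing N] [Algebra ℂ N] [StarModule ℂ N] [Group Γ]
  {τ : N →ₗ[ℂ] ℂ} {α : Γ →* (N ≃⋆ₐ[ℂ] N)} {T : M →ₗ[ℂ] ℂ} {A : StarSubalgebra ℂ M}
  {π : N →⋆ₐ[ℂ] M} {u : Γ →* unitary M} {e : M →ₗ[ℂ] N} {E : M → M}

/-- Faithfulness forces uniqueness. As `E` is a mere function, its additivity and bimodule behaviour
are all derived from this. -/
theorem expectation_eq (h : IsCrossedSystem τ α T A π u e) (hE : IsConditionalExpectation T A E)
    {x a : M} (ha : a ∈ A) (hx : ∀ b ∈ A, T (a * b) = T (x * b)) : E x = a := by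
  have hd : star (E x - a) ∈ A := star_mem (sub_mem (hE x).1 ha)
  have : star (E x - a) = 0 := by
    refine h.faithful _ ?_
    rw [star_star, sub_mul, map_sub, (hE x).2 _ hd, hx _ hd, sub_self]
  simpa [sub_eq_zero] using this

theorem expectation_add (h : IsCrossedSystem τ α T A π u e) (hE : IsConditionalExpectation T A E)
    (x y : M) : E (x + y) = E x + E y := by
  refine h.expectation_eq hE (add_mem (hE x).1 (hE y).1) fun b hb => ?_
  rw [add_mul, add_mul, map_add, map_add, (hE x).2 b hb, (hE y).2 b hb]

theorem expectation_sum (h : IsCrossedSystem τ α T A π u e) (hE : IsConditionalExpectation T A E)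
    {κ : Type*} (s : Finset κ) (f : κ → M) : E (∑ k ∈ s, f k) = ∑ k ∈ s, E (f k) := by
  refine h.expectation_eq hE (sum_mem fun k _ => (hE (f k)).1) fun b hb => ?_
  simp only [Finset.sum_mul, map_sum, (hE _).2 b hb]

/-- Since `e` is scalar on `A`, the trace is multiplicative between `π(N)` and `A`. -/
theorem trace_rep_mul (h : IsCrossedSystem τ α T A π u e) {a : M} (ha : a ∈ A) (b : N) :
    T (π b * a) = τ b * T a := by
  rw [h.trace_eq, h.map_rep_mul, h.map_eq_smul_one a ha, mul_smul_comm, mul_one, map_smul,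
    smul_eq_mul, mul_comm]

theorem expectation_mul_rep_mul (h : IsCrossedSystem τ α T A π u e)
    (hE : IsConditionalExpectation T A E) {a c : M} (ha : a ∈ A) (hc : c ∈ A) (b : N) :
    E (a * π b * c) = τ b • (a * c) := by
  refine h.expectation_eq hE (SMulMemClass.smul_mem _ (mul_mem ha hc)) fun d hd => ?_
  rw [smul_mul_assoc, map_smul, smul_eq_mul, mul_assoc a c d, h.tracial a, mul_assoc (a * π b),
    mul_assoc a, h.tracial a, mul_assoc (π b), h.trace_rep_mul (mul_mem (mul_mem hc hd) ha)]

theorem expectation_rep (h : IsCrossedSystem τ α T A π u e)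
    (hE : IsConditionalExpectation T A E) (b : N) : E (π b) = τ b • (1 : M) := by
  simpa using h.expectation_mul_rep_mul hE (one_mem A) (one_mem A) b

/-- `E` acts as an orthogonal projection: the cross terms of `‖x - E x‖₂² ≥ 0` both equal `‖E x‖₂²`.
-/
theorem twoNormSq_expectation_le (h : IsCrossedSystem τ α T A π u e)
    (hE : IsConditionalExpectation T A E) (x : M) : twoNormSq T (E x) ≤ twoNormSq T x := by
  have h0 := twoNormSq_nonneg h.nonneg (x - E x)
  have h1 : T (star (E x) * x) = T (star (E x) * E x) := by
    rw [h.tracial, h.tracial (star _), (hE x).2 _ (star_mem (hE x).1)]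
  have h2 : T (star x * E x) = star (T (star (E x) * E x)) := by
    rw [← h1, ← T.map_star_of_nonneg h.nonneg, star_mul, star_star]
  simp only [twoNormSq, star_sub, sub_mul, mul_sub, map_sub, Complex.sub_re, h1, h2,
    Complex.star_def, Complex.conj_re] at h0 ⊢
  linarith

theorem hasSum_twoNormSq (h : IsCrossedSystem τ α T A π u e) (x : M) :
    HasSum (fun g => twoNormSq τ (e (star (u g : M) * x))) (twoNormSq T x) :=
  Complex.hasSum_re (h.parseval x)

theorem hasSum_norm_sq (h : IsCrossedSystem τ α T A π u e) {a : M} (ha : a ∈ A) :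
    HasSum (fun g => ‖T (star (u g : M) * a)‖ ^ 2) (twoNormSq T a) := by
  refine (h.hasSum_twoNormSq a).congr_fun fun g => ?_
  rw [h.map_eq_smul_one _ (mul_mem (star_mem (h.unitary_mem g)) ha), twoNormSq_smul, twoNormSq]
  simp [h.map_one]

/-- The factor `v` cancels `v*`, leaving the coefficient of `E(π(b) v π(a))`. Moving `λ(g)*` past
`π(b)` isolates the scalar `e(λ(g)* v)`, and invariance of `τ` restores `α_g` on `a`. -/
theorem coefficient_expectation (h : IsCrossedSystem τ α T A π u e)
    (hE : IsConditionalExpectation T A E) {v : unitary M} (hv : (v : M) ∈ A) (a b : N) (g : Γ) :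
    T (star (u g : M) * (E (π b * (v * π a * star (v : M))) * v)) =
      T (star (u g : M) * v) * τ (b * α g a) := by
  have hug := star_mem (h.unitary_mem g)
  have h1 : star (u g : M) * π b = π (α g⁻¹ b) * star (u g : M) := by
    rw [Unitary.star_coe_map, h.covariant]
  have h2 : τ (α g⁻¹ b * a) = τ (b * α g a) := by
    rw [← h.invariant g, map_mul, ← StarAlgEquiv.mul_apply, ← map_mul α,
      mul_inv_cancel, _root_.map_one α]
    rfl
  have h3 : π b * (v * π a * star (v : M)) * (v * star (u g : M)) =
      π b * (v * π a) * star (u g : M) := by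
    simp only [mul_assoc]
    rw [← mul_assoc (star (v : M)), Unitary.coe_star_mul_self, one_mul]
  rw [h.tracial, mul_assoc, (hE _).2 _ (mul_mem hv hug), h3, h.tracial, ← mul_assoc, h1,
    mul_assoc, h.trace_eq, h.map_rep_mul, ← mul_assoc, h.map_mul_rep,
    h.map_eq_smul_one _ (mul_mem hug hv), smul_mul_assoc, one_mul, mul_smul_comm, map_smul, h2,
    smul_eq_mul]

theorem isWeaklyMixingAction (h : IsCrossedSystem τ α T A π u e)
    (hA : IsWeaklyMixingIn T A) : IsWeaklyMixingAction τ α := by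
  classical
  obtain ⟨G, hGA, -, E, hE, hmix⟩ := hA
  intro F ε hε
  set a₀ : N → N := fun a => a - τ a • (1 : N) with ha₀
  have hτ₀ : ∀ a, τ (a₀ a) = 0 := fun a => by simp [ha₀, h.map_one]
  have hE₀ : ∀ a, E (π (a₀ a)) = 0 := fun a => by rw [h.expectation_rep hE, hτ₀, zero_smul]
  set n : ℝ := (F.card : ℝ) with hn
  -- There are `n²` pairs, each contributing at most `δ²`, and `n² δ² < ε²`; the `+ 1` also covers
  -- an empty `F`.
  set δ : ℝ := ε / (n + 1) with hδ
  have hn0 : 0 ≤ n := Nat.cast_nonneg _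
  have hδ0 : 0 < δ := by positivity
  -- The adjoints compensate for the star on the first factor in relative mixing.
  obtain ⟨v, hv⟩ := hmix (F.image (fun a => π (a₀ a)) ∪ F.image fun b => π (a₀ (star b)))
    (by
      intro x hx
      simp only [Finset.mem_union, Finset.mem_image] at hx
      rcases hx with ⟨a, -, rfl⟩ | ⟨a, -, rfl⟩ <;> exact hE₀ _) δ hδ0
  by_contra! hcon
  have hvA := hGA v v.2
  set V : unitary M := (v : unitary M) with hV
  have ht : ∀ a b g, τ (star (a₀ (star b)) * α g (a₀ a)) = τ (α g a * b) - τ a * τ b := by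
    intro a b g
    have h1 : τ (α g (a₀ a)) = 0 := by rw [h.invariant, hτ₀]
    have h2 : star (a₀ (star b)) = b - star (τ (star b)) • (1 : N) := by simp [ha₀]
    rw [h2, sub_mul, map_sub, smul_mul_assoc, one_mul, map_smul, h1, smul_zero, sub_zero,
      h.tracial_base]
    simp [ha₀, sub_mul]
  set t : N → N → Γ → ℂ := fun a b g => τ (α g a * b) - τ a * τ b with htdef
  set w : N → N → M := fun a b =>
    E (star (π (a₀ (star b))) * (V * π (a₀ a) * star (V : M))) * V with hw
  have hsum : ∀ a b, HasSum (fun g => ‖T (star (u g : M) * V)‖ ^ 2 * ‖t a b g‖ ^ 2)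
      (twoNormSq T (w a b)) := by
    intro a b
    refine (h.hasSum_norm_sq (mul_mem (hE _).1 hvA)).congr_fun fun g => ?_
    rw [← map_star, h.coefficient_expectation hE hvA, ht, norm_mul, mul_pow]
  have hle : ∀ a ∈ F, ∀ b ∈ F, twoNormSq T (w a b) ≤ δ ^ 2 := by
    intro a ha b hb
    rw [hw, twoNormSq_mul_unitary h.tracial, ← twoNorm_le_iff hδ0.le]
    exact hv _ (Finset.mem_union_right _ (Finset.mem_image_of_mem _ hb)) _
      (Finset.mem_union_left _ (Finset.mem_image_of_mem _ ha))
  have hone : HasSum (fun g => ‖T (star (u g : M) * V)‖ ^ 2) 1 := by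
    have := h.hasSum_norm_sq hvA
    rwa [show twoNormSq T (V : M) = 1 by
      rw [twoNormSq, Unitary.coe_star_mul_self, h.trace_eq, h.map_one', h.map_one]
      rfl] at this
  have htot : HasSum (fun g => ∑ a ∈ F, ∑ b ∈ F, ‖T (star (u g : M) * V)‖ ^ 2 * ‖t a b g‖ ^ 2)
      (∑ a ∈ F, ∑ b ∈ F, twoNormSq T (w a b)) :=
    hasSum_sum fun a _ => hasSum_sum fun b _ => hsum a b
  -- If each `g` had a bad pair, the sum over all pairs would be at least `ε²` for every `g`;
  -- average this against weights of total mass one.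
  have hlow : ε ^ 2 ≤ ∑ a ∈ F, ∑ b ∈ F, twoNormSq T (w a b) := by
    have := hasSum_le (fun g => ?_) (hone.mul_right (ε ^ 2)) htot
    · rwa [one_mul] at this
    obtain ⟨a, ha, b, hb, hab⟩ := hcon g
    calc _ ≤ ‖T (star (u g : M) * V)‖ ^ 2 * ‖t a b g‖ ^ 2 := by gcongr
      _ ≤ ∑ b ∈ F, ‖T (star (u g : M) * V)‖ ^ 2 * ‖t a b g‖ ^ 2 :=
        Finset.single_le_sum (f := fun b => ‖T (star (u g : M) * V)‖ ^ 2 * ‖t a b g‖ ^ 2)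
          (fun _ _ => by positivity) hb
      _ ≤ _ := Finset.single_le_sum
          (f := fun a => ∑ b ∈ F, ‖T (star (u g : M) * V)‖ ^ 2 * ‖t a b g‖ ^ 2)
          (fun _ _ => Finset.sum_nonneg fun _ _ => by positivity) ha
  have hup : ∑ a ∈ F, ∑ b ∈ F, twoNormSq T (w a b) ≤ n * (n * δ ^ 2) := by
    calc _ ≤ ∑ a ∈ F, ∑ b ∈ F, δ ^ 2 :=
        Finset.sum_le_sum fun a ha => Finset.sum_le_sum fun b hb => hle a ha b hb
      _ = _ := by simp [hn]
  have hεδ : ε = δ * (n + 1) := (div_mul_cancel₀ ε (by positivity)).symm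
  have : 0 < δ ^ 2 := pow_pos hδ0 2
  rw [hεδ] at hlow
  nlinarith

/-- Elements with vanishing expectation are approximated in `‖·‖₂` by finite Fourier sums whose
coefficients have vanishing trace. -/
theorem exists_sum_twoNormSq_lt (h : IsCrossedSystem τ α T A π u e)
    (hE : IsConditionalExpectation T A E) {x : M} (hx : E x = 0) {δ : ℝ} (hδ : 0 < δ) :
    ∃ (s : Finset Γ) (c : Γ → N), (∀ g, τ (c g) = 0) ∧
      twoNormSq T (x - ∑ g ∈ s, (u g : M) * π (c g)) < δ := by
  classical
  set c : Γ → N := fun g => e (star (u g : M) * x) with hc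
  have hsum := h.hasSum_twoNormSq x
  -- By Parseval, `s` can carry all but `δ` of the squared norm. Subtracting the partial sum deletes
  -- exactly the coefficients in `s`.
  obtain ⟨s, hs⟩ := (hsum.eventually (lt_mem_nhds (sub_lt_self (twoNormSq T x) hδ))).exists
  refine ⟨s, c, fun g => ?_, ?_⟩
  · rw [hc, ← h.trace_eq, h.tracial, ← (hE x).2 _ (star_mem (h.unitary_mem g)), hx, zero_mul,
      map_zero]
  have hcoef : ∀ k, e (star (u k : M) * (x - ∑ g ∈ s, (u g : M) * π (c g))) =
      if k ∈ s then 0 else c k := by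
    intro k
    have h1 : ∀ g, e (star (u k : M) * ((u g : M) * π (c g))) = if k = g then c g else 0 := by
      intro g
      rw [← mul_assoc, h.map_mul_rep, Unitary.star_coe_map, ← Submonoid.coe_mul, ← map_mul u]
      split_ifs with hkg
      · subst hkg; simp [h.map_one']
      · rw [h.map_unitary _ fun h' => hkg (inv_mul_eq_one.mp h'), zero_mul]
    rw [mul_sub, map_sub, Finset.mul_sum, map_sum]
    simp only [h1, Finset.sum_ite_eq]
    split_ifs <;> simp [hc]
  have h2 := h.hasSum_twoNormSq (x - ∑ g ∈ s, (u g : M) * π (c g))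
  have h3 : HasSum (fun k => if k ∈ s then twoNormSq τ (c k) else 0)
      (∑ k ∈ s, twoNormSq τ (c k)) := by
    have := hasSum_sum_of_ne_finset_zero (L := .unconditional Γ) (s := s)
      (f := fun k => if k ∈ s then twoNormSq τ (c k) else 0) (fun k hk => if_neg hk)
    rwa [Finset.sum_congr rfl fun k hk => if_pos hk] at this
  have h4 := (hsum.sub h3).unique (h2.congr_fun fun k => ?_)
  · change twoNormSq T x - ∑ k ∈ s, twoNormSq τ (c k) = _ at h4
    change _ < ∑ k ∈ s, twoNormSq τ (c k) at hs
    linarith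
  · rw [hcoef]
    split_ifs <;> simp [hc, twoNormSq]

end IsCrossedSystem

end

noncomputable section

/-! ### From mixing of the action to mixing of the subalgebra. -/

namespace IsCrossedSystem

open Filter Topology

variable {M N Γ : Type*} [Ring M] [StarRing M] [Algebra ℂ M] [StarModule ℂ M]
  [Ring N] [StarRing N] [Algebra ℂ N] [StarModule ℂ N] [CommGroup Γ]
  {τ : N →ₗ[ℂ] ℂ} {α : Γ →* (N ≃⋆ₐ[ℂ] N)} {T : M →ₗ[ℂ] ℂ} {A : StarSubalgebra ℂ M}
  {π : N →⋆ₐ[ℂ] M} {u : Γ →* unitary M} {e : M →ₗ[ℂ] N} {E : M → M}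
  {ι : Type*} {l : Filter ι} {p : ι → Γ}

theorem tendsto_twoNormSq_expectation_monomial (h : IsCrossedSystem τ α T A π u e)
    (hE : IsConditionalExpectation T A E)
    (hp : ∀ a b, Tendsto (fun i => τ (α (p i) a * b)) l (𝓝 (τ a * τ b)))
    (g k : Γ) (b : N) {c : N} (hc : τ c = 0) :
    Tendsto (fun i => twoNormSq T (E (star ((u g : M) * π b) *
      (u (p i) * ((u k : M) * π c) * star (u (p i) : M))))) l (𝓝 0) := by
  have key : ∀ i, E (star ((u g : M) * π b) *
      (u (p i) * ((u k : M) * π c) * star (u (p i) : M))) =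
      τ (α (p i) (α k c) * star (α g b)) • ((u g⁻¹ : M) * u k) := by
    intro i
    have h1 : (u (p i) : M) * ((u k : M) * π c) * star (u (p i) : M) =
        π (α (p i) (α k c)) * u k := by
      rw [h.covariant k, ← mul_assoc, h.covariant, mul_assoc, mul_assoc, Unitary.star_coe_map,
        ← Submonoid.coe_mul, ← Submonoid.coe_mul, ← map_mul u, ← map_mul u]
      congr 3
      -- Commutativity of `Γ` enters here: conjugation by `u (p i)` fixes `u k`.
      rw [mul_comm k, mul_inv_cancel_left]
    have h2 : star ((u g : M) * π b) = (u g⁻¹ : M) * π (star (α g b)) := by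
      rw [h.covariant, star_mul, Unitary.star_coe_map, map_star]
    rw [h1, h2, mul_assoc, ← mul_assoc (π _), ← map_mul π, ← mul_assoc,
      h.expectation_mul_rep_mul hE (h.unitary_mem _) (h.unitary_mem _), h.tracial_base]
  simp only [key, twoNormSq_smul]
  have h0 := hp (α k c) (star (α g b))
  rw [h.invariant, hc, zero_mul] at h0
  simpa using (h0.norm.pow 2).mul_const (twoNormSq T ((u g⁻¹ : M) * u k))

theorem tendsto_twoNormSq_expectation_sum (h : IsCrossedSystem τ α T A π u e)
    (hE : IsConditionalExpectation T A E)
    (hp : ∀ a b, Tendsto (fun i => τ (α (p i) a * b)) l (𝓝 (τ a * τ b)))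
    (s t : Finset Γ) (b : Γ → N) {c : Γ → N} (hc : ∀ k, τ (c k) = 0) :
    Tendsto (fun i => twoNormSq T (E (star (∑ g ∈ s, (u g : M) * π (b g)) *
      (u (p i) * (∑ k ∈ t, (u k : M) * π (c k)) * star (u (p i) : M))))) l (𝓝 0) := by
  simp only [star_sum, Finset.sum_mul, Finset.mul_sum, h.expectation_sum hE]
  exact tendsto_twoNormSq_sum h.nonneg _ fun k _ => tendsto_twoNormSq_sum h.nonneg _ fun g _ =>
    h.tendsto_twoNormSq_expectation_monomial hE hp g k (b g) (hc k)

theorem tendsto_twoNormSq_expectation (h : IsCrossedSystem τ α T A π u e)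
    (hE : IsConditionalExpectation T A E)
    (hp : ∀ a b, Tendsto (fun i => τ (α (p i) a * b)) l (𝓝 (τ a * τ b)))
    {x y : M} (hx : E x = 0) (hy : E y = 0) :
    Tendsto (fun i => twoNormSq T (E (star x * (u (p i) * y * star (u (p i) : M))))) l
      (𝓝 0) := by
  refine (tendsto_order.mpr ⟨fun a ha => Eventually.of_forall fun i =>
    ha.trans_le (twoNormSq_nonneg h.nonneg _), fun ε hε => ?_⟩)
  -- The order of choices matters: `x₀` is chosen against the bound for `y*`, then `y₀` against the
  -- bound for `x₀*`, so no uniform operator bound on the approximants is needed. The final error is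
  -- at most `2·ε/8 + 4·(ε/16 + ε/16) < ε`.
  obtain ⟨C, hC0, hC⟩ := h.bounded (star y)
  obtain ⟨s, b, -, hs⟩ := h.exists_sum_twoNormSq_lt hE hx (δ := ε / (8 * C)) (by positivity)
  set x₀ := ∑ g ∈ s, (u g : M) * π (b g) with hx₀
  obtain ⟨D, hD0, hD⟩ := h.bounded (star x₀)
  obtain ⟨t, c, hc, ht⟩ := h.exists_sum_twoNormSq_lt hE hy (δ := ε / (16 * D)) (by positivity)
  set y₀ := ∑ k ∈ t, (u k : M) * π (c k) with hy₀
  have hlim := h.tendsto_twoNormSq_expectation_sum hE hp s t b hc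
  filter_upwards [hlim.eventually (gt_mem_nhds (show 0 < ε / 16 by positivity))] with i hi
  rw [← hx₀, ← hy₀] at hi
  set v : unitary M := u (p i) with hv
  have hz : star x * (v * y * star (v : M)) = star (x - x₀) * (v * y * star (v : M)) +
      (star x₀ * (v * (y - y₀) * star (v : M)) + star x₀ * (v * y₀ * star (v : M))) := by
    rw [star_sub]; noncomm_ring
  have h1 : twoNormSq T (star (x - x₀) * (v * y * star (v : M))) < ε / 8 := by
    -- Taking adjoints puts `y*` on the left, where its bound applies.
    have : star (star (x - x₀) * (v * y * star (v : M))) =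
        v * (star y * ((star v : unitary M) * (x - x₀))) := by
      simp only [star_mul, star_star, Unitary.coe_star, mul_assoc]
    rw [← twoNormSq_star h.tracial, this, twoNormSq_unitary_mul]
    calc _ ≤ C * twoNormSq T ((star v : unitary M) * (x - x₀)) := hC _
      _ = C * twoNormSq T (x - x₀) := by rw [twoNormSq_unitary_mul]
      _ < C * (ε / (8 * C)) := by gcongr
      _ = ε / 8 := by field_simp
  have h2 : twoNormSq T (star x₀ * (v * (y - y₀) * star (v : M))) < ε / 16 := by
    calc _ ≤ D * twoNormSq T (v * (y - y₀) * (star v : unitary M)) := hD _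
      _ = D * twoNormSq T (y - y₀) := by
        rw [twoNormSq_mul_unitary h.tracial, twoNormSq_unitary_mul]
      _ < D * (ε / (16 * D)) := by gcongr
      _ = ε / 16 := by field_simp
  have h3 := h.twoNormSq_expectation_le hE (star (x - x₀) * (v * y * star (v : M)))
  have h4 := h.twoNormSq_expectation_le hE (star x₀ * (v * (y - y₀) * star (v : M)))
  rw [hz, h.expectation_add hE, h.expectation_add hE]
  have h5 := twoNormSq_add_le h.nonneg (E (star (x - x₀) * (v * y * star (v : M))))
    (E (star x₀ * (v * (y - y₀) * star (v : M))) + E (star x₀ * (v * y₀ * star (v : M))))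
  have h6 := twoNormSq_add_le h.nonneg (E (star x₀ * (v * (y - y₀) * star (v : M))))
    (E (star x₀ * (v * y₀ * star (v : M))))
  linarith

end IsCrossedSystem

-- Indexing by a finite set and a tolerance `1/(n+1)` gives one net along which all correlations
-- converge.
open Filter Topology in
theorem IsWeaklyMixingAction.exists_tendsto {N Γ : Type*} [Ring N] [StarRing N] [Algebra ℂ N]
    [Group Γ] {τ : N →ₗ[ℂ] ℂ} {α : Γ →* (N ≃⋆ₐ[ℂ] N)}
    (hα : IsWeaklyMixingAction τ α) : ∃ p : Finset N × ℕ → Γ, ∀ a b,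
      Tendsto (fun i => τ (α (p i) a * b)) atTop (𝓝 (τ a * τ b)) := by
  classical
  choose p hp using fun i : Finset N × ℕ =>
    hα i.1 (1 / ((i.2 : ℝ) + 1)) Nat.one_div_pos_of_nat
  refine ⟨p, fun a b => ?_⟩
  rw [tendsto_iff_norm_sub_tendsto_zero]
  have hlim : Tendsto (fun i : Finset N × ℕ => 1 / ((i.2 : ℝ) + 1)) atTop (𝓝 0) := by
    rw [← prod_atTop_atTop_eq]
    exact tendsto_one_div_add_atTop_nhds_zero_nat.comp tendsto_snd
  refine squeeze_zero' (Eventually.of_forall fun _ => norm_nonneg _) ?_ hlim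
  filter_upwards [eventually_ge_atTop (({a, b} : Finset N), 0)] with i hi
  exact (hp i a (hi.1 (by simp)) b (hi.1 (by simp))).le

open Filter Topology in
theorem IsCrossedSystem.isWeaklyMixingIn {M N Γ : Type*} [Ring M] [StarRing M] [Algebra ℂ M]
    [StarModule ℂ M] [Ring N] [StarRing N] [Algebra ℂ N] [StarModule ℂ N] [CommGroup Γ]
    {τ : N →ₗ[ℂ] ℂ} {α : Γ →* (N ≃⋆ₐ[ℂ] N)} {T : M →ₗ[ℂ] ℂ} {A : StarSubalgebra ℂ M}
    {π : N →⋆ₐ[ℂ] M} {u : Γ →* unitary M} {e : M →ₗ[ℂ] N}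
    (h : IsCrossedSystem τ α T A π u e) (hα : IsWeaklyMixingAction τ α) :
    IsWeaklyMixingIn T A := by
  obtain ⟨E, hE⟩ := h.exists_conditionalExpectation
  have hmem : ∀ v ∈ u.range, (v : M) ∈ A := by
    rintro _ ⟨g, rfl⟩
    exact h.unitary_mem g
  -- The group is the canonical copy of `Γ`; it lies in `A`, so it normalizes `A`.
  refine ⟨u.range, hmem, fun v x => ?_, E, hE, fun F hF ε hε => ?_⟩
  · have hv := hmem v v.2
    have hv' := star_mem hv
    change ((v : unitary M) : M) * x * star ((v : unitary M) : M) ∈ A ↔ x ∈ A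
    refine ⟨fun hx => ?_, fun hx => mul_mem (mul_mem hv hx) hv'⟩
    have := mul_mem (mul_mem hv' hx) hv
    rwa [← mul_assoc, ← mul_assoc, Unitary.coe_star_mul_self, one_mul, mul_assoc,
      Unitary.coe_star_mul_self, mul_one] at this
  · classical
    obtain ⟨p, hp⟩ := hα.exists_tendsto
    have hev : ∀ᶠ i in atTop, ∀ x ∈ F, ∀ y ∈ F,
        twoNormSq T (E (star x * (u (p i) * y * star (u (p i) : M)))) < ε ^ 2 := by
      rw [Filter.eventually_all_finset]
      intro x hx
      rw [Filter.eventually_all_finset]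
      intro y hy
      exact (h.tendsto_twoNormSq_expectation hE hp (hF x hx) (hF y hy)).eventually
        (gt_mem_nhds (by positivity))
    obtain ⟨i, hi⟩ := hev.exists
    exact ⟨⟨u (p i), p i, rfl⟩, fun x hx y hy =>
      (twoNorm_le_iff hε.le _).mpr (hi x hx y hy).le⟩

end

/-! ### Left multiplication bounds and generated von Neumann algebras. -/

noncomputable section

/-- Write `‖x‖² - x*x = d*d` and apply positivity of `T` to `d y`. -/
theorem CStarAlgebra.twoNormSq_mul_le {A : Type*} [CStarAlgebra A] {T : A →ₗ[ℂ] ℂ}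
    (hT : ∀ x, 0 ≤ T (star x * x)) (x y : A) :
    twoNormSq T (x * y) ≤ ‖x‖ ^ 2 * twoNormSq T y := by
  let := CStarAlgebra.spectralOrder A
  have := CStarAlgebra.spectralOrderedRing A
  obtain ⟨d, hd⟩ := CStarAlgebra.nonneg_iff_eq_star_mul_self.mp
    (sub_nonneg.mpr (CStarAlgebra.star_mul_le_algebraMap_norm_sq (a := x)))
  have h1 := twoNormSq_nonneg hT (d * y)
  have h2 : star (d * y) * (d * y) =
      ((‖x‖ ^ 2 : ℝ) : ℂ) • (star y * y) - star (x * y) * (x * y) := by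
    rw [star_mul, mul_assoc, ← mul_assoc (star d), ← hd, sub_mul, mul_sub, star_mul,
      Algebra.algebraMap_eq_smul_one, smul_mul_assoc, one_mul, mul_smul_comm, mul_assoc (star y),
      mul_assoc (star x), Complex.coe_smul]
  rw [twoNormSq, h2, map_sub, map_smul, smul_eq_mul, Complex.sub_re, Complex.re_ofReal_mul] at h1
  rw [twoNormSq, twoNormSq]
  linarith

section Generated

variable {K : Type*} [NormedAddCommGroup K] [InnerProductSpace ℂ K] [CompleteSpace K]

theorem subset_vonNeumannGenerated (s : Set (K →L[ℂ] K)) :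
    s ⊆ ((vonNeumannGenerated s).toStarSubalgebra : Set (K →L[ℂ] K)) := by
  rw [coe_vonNeumannGenerated]
  exact Set.subset_union_left.trans Set.subset_centralizer_centralizer

theorem vonNeumannGenerated_subset_centralizer_centralizer {s S : Set (K →L[ℂ] K)} (hs : s ⊆ S)
    (hS : ∀ x ∈ S, star x ∈ S) :
    ((vonNeumannGenerated s).toStarSubalgebra : Set (K →L[ℂ] K)) ⊆
      S.centralizer.centralizer := by
  rw [coe_vonNeumannGenerated]
  refine Set.centralizer_subset (Set.centralizer_subset (Set.union_subset hs fun x hx => ?_))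
  simpa using hS _ (hs hx)

theorem VonNeumannAlgebra.isClosed_toStarSubalgebra (S : VonNeumannAlgebra K) :
    IsClosed (S.toStarSubalgebra : Set (K →L[ℂ] K)) := by
  rw [VonNeumannAlgebra.coe_toStarSubalgebra, ← S.centralizer_centralizer]
  exact Set.isClosed_centralizer _

theorem VonNeumannAlgebra.exists_twoNormSq_mul_le (S : VonNeumannAlgebra K)
    {T : S.toStarSubalgebra →ₗ[ℂ] ℂ} (hT : ∀ x, 0 ≤ T (star x * x)) (x : S.toStarSubalgebra) :
    ∃ C : ℝ, 0 < C ∧ ∀ y, twoNormSq T (x * y) ≤ C * twoNormSq T y := by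
  have : IsClosed (S.toStarSubalgebra : Set (K →L[ℂ] K)) := S.isClosed_toStarSubalgebra
  refine ⟨‖x‖ ^ 2 + 1, by positivity, fun y => ?_⟩
  have h1 := CStarAlgebra.twoNormSq_mul_le hT x y
  have h2 := twoNormSq_nonneg hT y
  linarith

end Generated

/-! ### Translations and matrix coefficients. -/

section Operators

variable {Γ ι : Type*} {H : Type*} [NormedAddCommGroup H] [InnerProductSpace ℂ H]

/-- The componentwise image of a sequence in `H` under the inclusion of `H` at `1 ∈ Γ`. -/
def deltaOne (Γ : Type*) [One Γ] (ξ : EllTwo ι H) : EllTwo ι (EllTwo Γ H) :=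
  ⟨fun i => delta 1 (ξ i), ellTwo_mem (by simpa only [norm_delta] using ellTwo_summable_sq ξ)⟩

theorem deltaOne_apply [One Γ] (ξ : EllTwo ι H) (i : ι) : deltaOne Γ ξ i = delta 1 (ξ i) := rfl

variable [Group Γ]

theorem translation_one : (translation 1 : EllTwo Γ H →L[ℂ] EllTwo Γ H) = 1 := by
  refine ContinuousLinearMap.ext fun f => lp.ext (funext fun g => ?_)
  simp

theorem translation_mul (g h : Γ) :
    (translation (g * h) : EllTwo Γ H →L[ℂ] EllTwo Γ H) = translation g * translation h := by
  refine ContinuousLinearMap.ext fun f => lp.ext (funext fun k => ?_)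
  rw [mul_apply_eq_comp, translation_apply, translation_apply, translation_apply, mul_inv_rev,
    mul_assoc]

theorem translation_delta (g h : Γ) (v : H) :
    translation g (delta h v) = delta (g * h) v := by
  refine lp.ext (funext fun k => ?_)
  rw [translation_apply, delta_apply, delta_apply]
  classical exact if_congr inv_mul_eq_iff_eq_mul rfl rfl

variable [CompleteSpace H]

theorem unitCorner_apply_delta (x : EllTwo Γ H →L[ℂ] EllTwo Γ H) (v : H) :
    unitCorner x v = x (delta 1 v) 1 := by
  classical
  rw [unitCorner_apply]
  congr 2

theorem star_translation (g : Γ) :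
    star (translation g : EllTwo Γ H →L[ℂ] EllTwo Γ H) = translation g⁻¹ := by
  symm
  refine (ContinuousLinearMap.eq_adjoint_iff _ _).mpr fun f f' => ?_
  rw [lp.inner_eq_tsum, lp.inner_eq_tsum,
    ← (Equiv.mulLeft g).tsum_eq fun k => inner ℂ (f k) (translation g f' k)]
  simp

/-- The Fourier coefficients of `x` form the column at `1` of its matrix. -/
theorem unitCorner_star_translation_mul_apply (x : EllTwo Γ H →L[ℂ] EllTwo Γ H) (g : Γ) (v : H) :
    unitCorner (star (translation g : EllTwo Γ H →L[ℂ] EllTwo Γ H) * x) v = x (delta 1 v) g := by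
  rw [unitCorner_apply_delta, star_translation, mul_apply_eq_comp, translation_apply]
  simp

end Operators

/-! ### Generators, corner expectation and monomials of the crossed product. -/

section CrossedRep

variable {Γ : Type*} {H : Type*} [NormedAddCommGroup H] [InnerProductSpace ℂ H] [CompleteSpace H]
  [Group Γ] (B : VonNeumannAlgebra H)
  (α : Γ →* (B.toStarSubalgebra ≃⋆ₐ[ℂ] B.toStarSubalgebra))

theorem crossedRep_apply (b : B.toStarSubalgebra) (f : EllTwo Γ H) (g : Γ) :
    crossedRep B α b f g = ((α g⁻¹ b : B.toStarSubalgebra) : H →L[ℂ] H) (f g) := rfl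

theorem crossedRep_delta (b : B.toStarSubalgebra) (g : Γ) (v : H) :
    crossedRep B α b (delta g v) = delta g (((α g⁻¹ b : B.toStarSubalgebra) : H →L[ℂ] H) v) := by
  refine lp.ext (funext fun k => ?_)
  rw [crossedRep_apply, delta_apply, delta_apply]
  split_ifs with h
  · rw [h]
  · rw [map_zero]

theorem star_crossedRep (b : B.toStarSubalgebra) :
    crossedRep B α (star b) = star (crossedRep B α b) := by
  refine (ContinuousLinearMap.eq_adjoint_iff _ _).mpr fun f f' => ?_
  rw [lp.inner_eq_tsum, lp.inner_eq_tsum]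
  refine tsum_congr fun g => ?_
  rw [crossedRep_apply, crossedRep_apply, map_star, StarMemClass.coe_star,
    ContinuousLinearMap.star_eq_adjoint, ContinuousLinearMap.adjoint_inner_left]

theorem crossedRep_mem (b : B.toStarSubalgebra) :
    crossedRep B α b ∈ (crossedProduct B α).toStarSubalgebra :=
  subset_vonNeumannGenerated _ (Or.inl ⟨b, rfl⟩)

theorem translation_mem (g : Γ) : translation g ∈ (crossedProduct B α).toStarSubalgebra :=
  subset_vonNeumannGenerated _ (Or.inr ⟨g, rfl⟩)

/-- The embedding of `B` into the crossed product. -/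
def crossedRepHom : B.toStarSubalgebra →⋆ₐ[ℂ] (crossedProduct B α).toStarSubalgebra where
  toFun b := ⟨crossedRep B α b, crossedRep_mem B α b⟩
  map_one' := Subtype.ext <| ContinuousLinearMap.ext fun f => lp.ext <| funext fun g => by
    change ((α g⁻¹ 1 : B.toStarSubalgebra) : H →L[ℂ] H) (f g) = f g
    rw [map_one]; rfl
  map_mul' a b := Subtype.ext <| ContinuousLinearMap.ext fun f => lp.ext <| funext fun g => by
    change ((α g⁻¹ (a * b) : B.toStarSubalgebra) : H →L[ℂ] H) (f g) = _
    rw [map_mul]; rfl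
  map_zero' := Subtype.ext <| ContinuousLinearMap.ext fun f => lp.ext <| funext fun g => by
    change ((α g⁻¹ 0 : B.toStarSubalgebra) : H →L[ℂ] H) (f g) = 0
    rw [map_zero]; rfl
  map_add' a b := Subtype.ext <| ContinuousLinearMap.ext fun f => lp.ext <| funext fun g => by
    change ((α g⁻¹ (a + b) : B.toStarSubalgebra) : H →L[ℂ] H) (f g) = _
    rw [map_add]; rfl
  commutes' r := Subtype.ext <| ContinuousLinearMap.ext fun f => lp.ext <| funext fun g => by
    change ((α g⁻¹ (algebraMap ℂ _ r) : B.toStarSubalgebra) : H →L[ℂ] H) (f g) = r • f g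
    rw [Algebra.algebraMap_eq_smul_one, map_smul, map_one]; rfl
  map_star' b := Subtype.ext (star_crossedRep B α b)

theorem coe_crossedRepHom (b : B.toStarSubalgebra) :
    (crossedRepHom B α b : EllTwo Γ H →L[ℂ] EllTwo Γ H) = crossedRep B α b := rfl

/-- The canonical unitaries of the crossed product. -/
def translationHom : Γ →* unitary (crossedProduct B α).toStarSubalgebra where
  toFun g := ⟨⟨translation g, translation_mem B α g⟩, by
    refine Unitary.mem_iff.mpr ⟨Subtype.ext ?_, Subtype.ext ?_⟩
    · change star (translation g : EllTwo Γ H →L[ℂ] EllTwo Γ H) * translation g = 1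
      rw [star_translation, ← translation_mul, inv_mul_cancel, translation_one]
    · change translation g * star (translation g : EllTwo Γ H →L[ℂ] EllTwo Γ H) = 1
      rw [star_translation, ← translation_mul, mul_inv_cancel, translation_one]⟩
  map_one' := Subtype.ext (Subtype.ext translation_one)
  map_mul' g h := Subtype.ext (Subtype.ext (translation_mul g h))

theorem coe_translationHom (g : Γ) : (((translationHom B α g : unitary _) :
    (crossedProduct B α).toStarSubalgebra) : EllTwo Γ H →L[ℂ] EllTwo Γ H) = translation g := rfl

/-- The canonical conditional expectation of the crossed product onto `B`. -/
def crossedExpectation : (crossedProduct B α).toStarSubalgebra →ₗ[ℂ] B.toStarSubalgebra where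
  toFun x := ⟨unitCorner (x : EllTwo Γ H →L[ℂ] EllTwo Γ H), unitCorner_mem B α x.2⟩
  map_add' _ _ := Subtype.ext (map_add unitCorner _ _)
  map_smul' c _ := Subtype.ext (map_smul unitCorner c _)

theorem crossedExpectation_apply (x : (crossedProduct B α).toStarSubalgebra) (v : H) :
    ((crossedExpectation B α x : B.toStarSubalgebra) : H →L[ℂ] H) v =
      (x : EllTwo Γ H →L[ℂ] EllTwo Γ H) (delta 1 v) 1 :=
  unitCorner_apply_delta _ _

theorem crossedExpectation_star_translationHom_mul_apply
    (x : (crossedProduct B α).toStarSubalgebra) (g : Γ) (v : H) :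
    ((crossedExpectation B α (star ((translationHom B α g : unitary _) :
      (crossedProduct B α).toStarSubalgebra) * x) : B.toStarSubalgebra) : H →L[ℂ] H) v =
      (x : EllTwo Γ H →L[ℂ] EllTwo Γ H) (delta 1 v) g :=
  unitCorner_star_translation_mul_apply _ _ _

theorem translation_mul_crossedRep (g : Γ) (b : B.toStarSubalgebra) :
    translation g * crossedRep B α b = crossedRep B α (α g b) * translation g := by
  refine ContinuousLinearMap.ext fun f => lp.ext (funext fun k => ?_)
  rw [mul_apply_eq_comp, mul_apply_eq_comp, translation_apply, crossedRep_apply, crossedRep_apply,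
    translation_apply, ← StarAlgEquiv.mul_apply, ← map_mul]
  congr 4
  group

theorem crossedExpectation_rep_mul (b : B.toStarSubalgebra)
    (x : (crossedProduct B α).toStarSubalgebra) :
    crossedExpectation B α (crossedRepHom B α b * x) = b * crossedExpectation B α x := by
  refine Subtype.ext (ContinuousLinearMap.ext fun v => ?_)
  rw [crossedExpectation_apply, MulMemClass.coe_mul, mul_apply_eq_comp, coe_crossedRepHom,
    crossedRep_apply, inv_one, map_one, MulMemClass.coe_mul, mul_apply_eq_comp,
    crossedExpectation_apply]
  rfl

theorem crossedExpectation_mul_rep (b : B.toStarSubalgebra)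
    (x : (crossedProduct B α).toStarSubalgebra) :
    crossedExpectation B α (x * crossedRepHom B α b) = crossedExpectation B α x * b := by
  refine Subtype.ext (ContinuousLinearMap.ext fun v => ?_)
  rw [crossedExpectation_apply, MulMemClass.coe_mul, mul_apply_eq_comp, coe_crossedRepHom,
    crossedRep_delta, inv_one, map_one, MulMemClass.coe_mul, mul_apply_eq_comp,
    crossedExpectation_apply]
  rfl

/-- The monomials `π(b) λ(g)`, which span a weakly dense subalgebra of the crossed product. -/
def crossedMonomials : Set (EllTwo Γ H →L[ℂ] EllTwo Γ H) :=
  Set.range fun p : B.toStarSubalgebra × Γ => crossedRep B α p.1 * translation p.2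

theorem crossedRep_mul (a b : B.toStarSubalgebra) :
    crossedRep B α (a * b) = crossedRep B α a * crossedRep B α b :=
  congrArg Subtype.val (map_mul (crossedRepHom B α) a b)

theorem crossedRep_one : crossedRep B α 1 = 1 :=
  congrArg Subtype.val (map_one (crossedRepHom B α))

theorem crossedRep_mul_translation_mul (a b : B.toStarSubalgebra) (g h : Γ) :
    crossedRep B α a * translation g * (crossedRep B α b * translation h) =
      crossedRep B α (a * α g b) * translation (g * h) := by
  rw [crossedRep_mul, translation_mul, mul_assoc, ← mul_assoc (translation g),
    translation_mul_crossedRep]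
  simp only [mul_assoc]

theorem one_mem_crossedMonomials : 1 ∈ crossedMonomials B α :=
  ⟨(1, 1), by simp only [crossedRep_one, translation_one, one_mul]⟩

theorem mul_mem_crossedMonomials : ∀ s ∈ crossedMonomials B α, ∀ t ∈ crossedMonomials B α,
    s * t ∈ crossedMonomials B α := by
  rintro _ ⟨⟨a, g⟩, rfl⟩ _ ⟨⟨b, h⟩, rfl⟩
  exact ⟨(a * α g b, g * h), (crossedRep_mul_translation_mul B α a b g h).symm⟩

theorem star_mem_crossedMonomials : ∀ s ∈ crossedMonomials B α, star s ∈ crossedMonomials B α := by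
  rintro _ ⟨⟨a, g⟩, rfl⟩
  refine ⟨(α g⁻¹ (star a), g⁻¹), ?_⟩
  simp only [star_mul, star_translation, ← star_crossedRep, translation_mul_crossedRep]

theorem crossedProduct_subset :
    ((crossedProduct B α).toStarSubalgebra : Set (EllTwo Γ H →L[ℂ] EllTwo Γ H)) ⊆
      (crossedMonomials B α).centralizer.centralizer := by
  refine vonNeumannGenerated_subset_centralizer_centralizer (Set.union_subset ?_ ?_)
    (star_mem_crossedMonomials B α)
  · rintro _ ⟨b, rfl⟩
    exact ⟨(b, 1), by simp only [translation_one, mul_one]⟩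
  · rintro _ ⟨g, rfl⟩
    exact ⟨(1, g), by simp only [crossedRep_one, one_mul]⟩

theorem translationAlgebra_subset :
    ((vonNeumannGenerated (Set.range
      (translation : Γ → EllTwo Γ H →L[ℂ] EllTwo Γ H))).toStarSubalgebra :
      Set (EllTwo Γ H →L[ℂ] EllTwo Γ H)) ⊆
      (Set.range (translation : Γ → EllTwo Γ H →L[ℂ] EllTwo Γ H)).centralizer.centralizer := by
  refine vonNeumannGenerated_subset_centralizer_centralizer subset_rfl ?_
  rintro _ ⟨g, rfl⟩
  exact ⟨g⁻¹, (star_translation g).symm⟩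

end CrossedRep

end

noncomputable section

/-! ### Traciality, Parseval and faithfulness of the crossed trace. -/

section CrossedTrace

variable {Γ : Type*} {H : Type*} [NormedAddCommGroup H] [InnerProductSpace ℂ H] [CompleteSpace H]
  [Group Γ] {B : VonNeumannAlgebra H}
  {α : Γ →* (B.toStarSubalgebra ≃⋆ₐ[ℂ] B.toStarSubalgebra)} {τ : B.toStarSubalgebra →ₗ[ℂ] ℂ}

theorem IsNormalFaithfulTrace.exists_inner_amp (hτ : IsNormalFaithfulTrace B τ) :
    ∃ η ξ : EllTwo ℕ H, ∀ b : B.toStarSubalgebra, τ b = inner ℂ η (amp ℕ (b : H →L[ℂ] H) ξ) := by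
  obtain ⟨ξ, η, hξ, hη, h⟩ := hτ.normal
  exact ⟨⟨η, ellTwo_mem hη⟩, ⟨ξ, ellTwo_mem hξ⟩, fun b => (h b).unique (hasSum_inner_amp _ _ _)⟩

theorem crossedTrace_apply (x : (crossedProduct B α).toStarSubalgebra) :
    crossedTrace B α τ x = τ (crossedExpectation B α x) := rfl

/-- The crossed trace inherits normality: its vectors are those of `τ`, placed at the identity of
`Γ`. -/
theorem crossedTrace_eq_inner_amp {η ξ : EllTwo ℕ H}
    (h : ∀ b : B.toStarSubalgebra, τ b = inner ℂ η (amp ℕ (b : H →L[ℂ] H) ξ))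
    (x : (crossedProduct B α).toStarSubalgebra) :
    crossedTrace B α τ x = inner ℂ (deltaOne Γ η)
      (amp ℕ (x : EllTwo Γ H →L[ℂ] EllTwo Γ H) (deltaOne Γ ξ)) := by
  rw [crossedTrace_apply, h]
  refine (hasSum_inner_amp _ _ _).unique
    ((hasSum_inner_amp (deltaOne Γ η) (deltaOne Γ ξ) _).congr_fun fun n => ?_)
  rw [crossedExpectation_apply, deltaOne_apply, deltaOne_apply, inner_delta_left]

theorem crossedExpectation_translationHom {g : Γ} (hg : g ≠ 1) :
    crossedExpectation B α
      ((translationHom B α g : unitary _) : (crossedProduct B α).toStarSubalgebra) = 0 := by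
  refine Subtype.ext (ContinuousLinearMap.ext fun v => ?_)
  rw [crossedExpectation_apply, coe_translationHom, translation_delta, delta_apply, mul_one,
    if_neg (Ne.symm hg)]
  rfl

theorem crossedExpectation_one :
    crossedExpectation B α (1 : (crossedProduct B α).toStarSubalgebra) = 1 := by
  refine Subtype.ext (ContinuousLinearMap.ext fun v => ?_)
  rw [crossedExpectation_apply]
  change (delta (1 : Γ) v : EllTwo Γ H) 1 = v
  rw [delta_apply, if_pos rfl]

theorem crossedTrace_monomial (b : B.toStarSubalgebra) (g : Γ) [Decidable (g = 1)] :
    crossedTrace B α τ (crossedRepHom B α b * (translationHom B α g : unitary _)) =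
      if g = 1 then τ b else 0 := by
  rw [crossedTrace_apply, crossedExpectation_rep_mul]
  split_ifs with hg
  · rw [hg, map_one, Submonoid.coe_one, crossedExpectation_one, mul_one]
  · rw [crossedExpectation_translationHom hg, mul_zero, map_zero]

/-- The monomials `π(b) λ(g)` as elements of the crossed product. -/
def crossedMonomial (b : B.toStarSubalgebra) (g : Γ) : (crossedProduct B α).toStarSubalgebra :=
  crossedRepHom B α b * (translationHom B α g : unitary _)

theorem crossedMonomial_mul (a b : B.toStarSubalgebra) (g h : Γ) :
    (crossedMonomial a g * crossedMonomial b h : (crossedProduct B α).toStarSubalgebra) =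
      crossedMonomial (a * α g b) (g * h) :=
  Subtype.ext (crossedRep_mul_translation_mul B α a b g h)

/-- Both sides vanish unless `g h = 1`; then apply `α h` inside `τ` and use that `τ` is a trace. -/
theorem crossedTrace_monomial_mul_comm (hτ : IsNormalFaithfulTrace B τ) (hα : PreservesTrace τ α)
    (a b : B.toStarSubalgebra) (g h : Γ) :
    crossedTrace B α τ (crossedMonomial a g * crossedMonomial b h) =
      crossedTrace B α τ (crossedMonomial b h * crossedMonomial a g) := by
  classical
  rw [crossedMonomial_mul, crossedMonomial_mul, crossedMonomial, crossedMonomial,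
    crossedTrace_monomial, crossedTrace_monomial]
  have hiff : g * h = 1 ↔ h * g = 1 := mul_eq_one_comm
  by_cases hg : g * h = 1
  · rw [if_pos hg, if_pos (hiff.mp hg), ← hα h, map_mul, ← StarAlgEquiv.mul_apply, ← map_mul α,
      hiff.mp hg, map_one α, hτ.tracial]
    rfl
  · rw [if_neg hg, if_neg (hiff.not.mp hg)]

theorem crossedTrace_mul_comm (hτ : IsNormalFaithfulTrace B τ) (hα : PreservesTrace τ α)
    (x y : (crossedProduct B α).toStarSubalgebra) :
    crossedTrace B α τ (x * y) = crossedTrace B α τ (y * x) := by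
  obtain ⟨η, ξ, h⟩ := hτ.exists_inner_amp
  have key : ∀ y : (crossedProduct B α).toStarSubalgebra,
      (∀ a g, crossedTrace B α τ (crossedMonomial a g * y) =
        crossedTrace B α τ (y * crossedMonomial a g)) →
      ∀ x, crossedTrace B α τ (x * y) = crossedTrace B α τ (y * x) := by
    intro y hy x
    have h1 : ∀ x : (crossedProduct B α).toStarSubalgebra, crossedTrace B α τ (x * y) =
        inner ℂ (deltaOne Γ η) (amp ℕ (x : EllTwo Γ H →L[ℂ] EllTwo Γ H)
          (amp ℕ (y : EllTwo Γ H →L[ℂ] EllTwo Γ H) (deltaOne Γ ξ))) := fun x =>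
      crossedTrace_eq_inner_amp h _
    have h2 : ∀ x : (crossedProduct B α).toStarSubalgebra, crossedTrace B α τ (y * x) =
        inner ℂ (amp ℕ (star (y : EllTwo Γ H →L[ℂ] EllTwo Γ H)) (deltaOne Γ η))
          (amp ℕ (x : EllTwo Γ H →L[ℂ] EllTwo Γ H) (deltaOne Γ ξ)) := fun x => by
      rw [inner_amp_left, star_star]
      exact crossedTrace_eq_inner_amp h _
    rw [h1, h2]
    refine inner_amp_eq_of_mem_centralizer_centralizer (one_mem_crossedMonomials B α)
      (mul_mem_crossedMonomials B α) (star_mem_crossedMonomials B α) ?_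
      (crossedProduct_subset B α x.2)
    rintro _ ⟨⟨a, g⟩, rfl⟩
    exact (h1 (crossedMonomial a g)).symm.trans ((hy a g).trans (h2 (crossedMonomial a g)))
  -- Density is used one variable at a time: monomial against monomial, then against arbitrary
  -- elements, then both arbitrary.
  exact key y (fun a g => (key _ (fun b k => crossedTrace_monomial_mul_comm hτ hα b a k g) y).symm) x

/-- Both sides are iterated sums of one absolutely convergent family over `ℕ × Γ`: summing over `Γ`
first gives the trace, summing over `ℕ` first gives the coefficient terms. -/
theorem hasSum_crossedTrace_star_mul_self (hτ : IsNormalFaithfulTrace B τ)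
    (x : (crossedProduct B α).toStarSubalgebra) :
    HasSum (fun g => τ (star (crossedExpectation B α
        (star ((translationHom B α g : unitary _) : (crossedProduct B α).toStarSubalgebra) * x)) *
      crossedExpectation B α
        (star ((translationHom B α g : unitary _) : (crossedProduct B α).toStarSubalgebra) * x)))
      (crossedTrace B α τ (star x * x)) := by
  obtain ⟨η, ξ, h⟩ := hτ.exists_inner_amp
  set X : EllTwo Γ H →L[ℂ] EllTwo Γ H := x.1 with hX
  set c : Γ → B.toStarSubalgebra := fun g => crossedExpectation B α
    (star ((translationHom B α g : unitary _) : (crossedProduct B α).toStarSubalgebra) * x) with hc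
  have hcX : ∀ g v, (c g : H →L[ℂ] H) v = X (delta 1 v) g := fun g v =>
    crossedExpectation_star_translationHom_mul_apply B α x g v
  have hsum : ∀ ζ : EllTwo ℕ H, Summable fun p : ℕ × Γ => ‖X (delta 1 (ζ p.1)) p.2‖ ^ 2 := by
    intro ζ
    refine (summable_prod_of_nonneg fun p => sq_nonneg _).mpr
      ⟨fun n => ellTwo_summable_sq (X (delta 1 (ζ n))), ?_⟩
    simp only [← ellTwo_norm_sq]
    exact ellTwo_summable_sq (amp ℕ X (deltaOne Γ ζ))
  have h1 := lp.hasSum_inner (𝕜 := ℂ) (⟨_, ellTwo_mem (hsum η)⟩ : EllTwo (ℕ × Γ) H)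
    ⟨_, ellTwo_mem (hsum ξ)⟩
  have h2 := h1.prod_fiberwise fun n =>
    lp.hasSum_inner (𝕜 := ℂ) (X (delta 1 (η n))) (X (delta 1 (ξ n)))
  have h3 : HasSum (fun n => inner ℂ (X (delta 1 (η n))) (X (delta 1 (ξ n))))
      (crossedTrace B α τ (star x * x)) := by
    rw [crossedTrace_eq_inner_amp h]
    refine (hasSum_inner_amp _ _ _).congr_fun fun n => ?_
    rw [deltaOne_apply, deltaOne_apply, MulMemClass.coe_mul, mul_apply_eq_comp,
      StarMemClass.coe_star, ContinuousLinearMap.star_eq_adjoint,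
      ContinuousLinearMap.adjoint_inner_right]
  rw [h3.unique h2]
  refine HasSum.prod_fiberwise ((Equiv.prodComm Γ ℕ).hasSum_iff.mpr h1) fun g => ?_
  rw [h]
  refine (hasSum_inner_amp _ _ _).congr_fun fun n => ?_
  rw [MulMemClass.coe_mul, mul_apply_eq_comp, StarMemClass.coe_star,
    ContinuousLinearMap.star_eq_adjoint, ContinuousLinearMap.adjoint_inner_right, hcX, hcX]
  rfl

theorem crossedTrace_nonneg (hτ : IsNormalFaithfulTrace B τ)
    (x : (crossedProduct B α).toStarSubalgebra) : 0 ≤ crossedTrace B α τ (star x * x) :=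
  (hasSum_crossedTrace_star_mul_self hτ x).nonneg fun _ => hτ.nonneg _

/-- Parseval and faithfulness of `τ` kill the column at `1`. Traciality carries the hypothesis over
to `x λ(g)`, which kills the column at `g`. -/
theorem crossedTrace_faithful (hτ : IsNormalFaithfulTrace B τ) (hα : PreservesTrace τ α)
    (x : (crossedProduct B α).toStarSubalgebra) (hx : crossedTrace B α τ (star x * x) = 0) :
    x = 0 := by
  have key : ∀ y : (crossedProduct B α).toStarSubalgebra,
      crossedTrace B α τ (star y * y) = 0 → ∀ v,
        (y : EllTwo Γ H →L[ℂ] EllTwo Γ H) (delta 1 v) = 0 := by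
    intro y hy v
    have h := hasSum_crossedTrace_star_mul_self hτ y
    rw [hy, hasSum_zero_iff_of_nonneg fun _ => hτ.nonneg _] at h
    refine lp.ext (funext fun g => ?_)
    rw [← crossedExpectation_star_translationHom_mul_apply B α y g v,
      hτ.faithful _ (congrFun h g)]
    rfl
  refine Subtype.ext (continuousLinearMap_ext_delta fun g v => ?_)
  have h1 := key (x * (translationHom B α g : unitary _)) (by
    rw [star_mul, mul_assoc, crossedTrace_mul_comm hτ hα, mul_assoc, mul_assoc, ← Unitary.coe_star,
      Unitary.coe_mul_star_self, mul_one, hx]) v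
  rw [MulMemClass.coe_mul, mul_apply_eq_comp, coe_translationHom, translation_delta, mul_one] at h1
  exact h1

theorem crossedExpectation_eq_smul_one (hτ : IsNormalFaithfulTrace B τ)
    (a : (crossedProduct B α).toStarSubalgebra) (ha : a ∈ crossedGroupAlgebra B α) :
    crossedExpectation B α a = crossedTrace B α τ a • 1 := by
  classical
  obtain ⟨η, ξ, h⟩ := hτ.exists_inner_amp
  refine Subtype.ext (ContinuousLinearMap.ext fun w => ext_inner_left ℂ fun u => ?_)
  have h1 : ∀ x : (crossedProduct B α).toStarSubalgebra,
      inner ℂ u (((crossedExpectation B α x : B.toStarSubalgebra) : H →L[ℂ] H) w) =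
      inner ℂ (delta () (delta 1 u) : EllTwo Unit (EllTwo Γ H))
        (amp Unit (x : EllTwo Γ H →L[ℂ] EllTwo Γ H) (delta () (delta 1 w))) := fun x => by
    rw [amp_delta, inner_delta_left, delta_apply, if_pos rfl, inner_delta_left,
      crossedExpectation_apply]
  -- Absorbing `⟨u, w⟩` into the vector makes the scalar side a normal functional too, so it
  -- suffices to compare on translations.
  have h2 : ∀ x : (crossedProduct B α).toStarSubalgebra,
      inner ℂ u (((crossedTrace B α τ x • 1 : B.toStarSubalgebra) : H →L[ℂ] H) w) =
      inner ℂ (deltaOne Γ η) (amp ℕ (x : EllTwo Γ H →L[ℂ] EllTwo Γ H)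
        ((inner ℂ u w : ℂ) • deltaOne Γ ξ)) := fun x => by
    rw [map_smul, inner_smul_right, ← crossedTrace_eq_inner_amp h, mul_comm]
    exact inner_smul_right _ _ _
  rw [h1, h2]
  refine inner_amp_eq_of_mem_centralizer_centralizer (S := Set.range translation)
    ⟨1, translation_one⟩ ?_ ?_ ?_
    (translationAlgebra_subset ha)
  · rintro _ ⟨g, rfl⟩ _ ⟨k, rfl⟩
    exact ⟨g * k, translation_mul g k⟩
  · rintro _ ⟨g, rfl⟩
    exact ⟨g⁻¹, (star_translation g).symm⟩
  · rintro _ ⟨g, rfl⟩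
    rw [← coe_translationHom B α g, ← h1, ← h2]
    congr 3
    rw [crossedTrace_apply]
    by_cases hg : g = 1
    · rw [hg, map_one, Submonoid.coe_one, crossedExpectation_one, hτ.map_one, one_smul]
    · rw [crossedExpectation_translationHom hg, map_zero, zero_smul]

end CrossedTrace

end

noncomputable section

/-! ### The slice `id ⊗ τ` as conditional expectation onto `L(Γ)`. -/

section SliceExpectation

variable {Γ I : Type*} {H : Type*} [NormedAddCommGroup H] [InnerProductSpace ℂ H] [CompleteSpace H]
  [Group Γ] {B : VonNeumannAlgebra H}
  {α : Γ →* (B.toStarSubalgebra ≃⋆ₐ[ℂ] B.toStarSubalgebra)} {τ : B.toStarSubalgebra →ₗ[ℂ] ℂ}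

/-- The nonzero entries of `π(b) λ(g)` are translates of `b` under `α`; invariance gives them all
the scalar `τ(b)`. -/
theorem sliceOp_monomial (e : HilbertBasis I ℂ H) {η ξ : EllTwo ℕ H}
    (h : ∀ b : B.toStarSubalgebra, τ b = inner ℂ η (amp ℕ (b : H →L[ℂ] H) ξ))
    (hα : PreservesTrace τ α) (b : B.toStarSubalgebra) (g : Γ) :
    sliceOp e η ξ (crossedRep B α b * translation g) = τ b • translation g := by
  classical
  refine continuousLinearMap_ext_delta fun k w => lp.ext (funext fun m => ?_)
  have happ : ∀ v : H, (crossedRep B α b * translation g : EllTwo Γ H →L[ℂ] EllTwo Γ H)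
      (delta k v) m =
        if m = g * k then ((α (g * k)⁻¹ b : B.toStarSubalgebra) : H →L[ℂ] H) v else 0 := by
    intro v
    rw [mul_apply_eq_comp, translation_delta, crossedRep_delta, delta_apply]
  have hsum : HasSum (fun n => inner ℂ (η n)
      ((crossedRep B α b * translation g : EllTwo Γ H →L[ℂ] EllTwo Γ H) (delta k (ξ n)) m))
      (if m = g * k then τ b else 0) := by
    simp only [happ]
    by_cases hm : m = g * k
    · simp only [if_pos hm]
      rw [← hα (g * k)⁻¹, h]
      exact hasSum_inner_amp _ _ _
    · simp only [if_neg hm, inner_zero_right]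
      exact hasSum_zero
  rw [sliceOp_delta_apply e η ξ _ m k w hsum]
  change _ = τ b • (translation g (delta k w) : EllTwo Γ H) m
  rw [translation_delta, delta_apply]
  by_cases hm : m = g * k
  · rw [if_pos hm, if_pos hm]
  · rw [if_neg hm, if_neg hm, zero_smul, smul_zero]

/-- For `R` in the commutant of the translations and their adjoints, commuting with the slice of `x`
is an equality of normal functionals of `x`, so monomials suffice. -/
theorem sliceOp_mem (e : HilbertBasis I ℂ H) {η ξ : EllTwo ℕ H}
    (h : ∀ b : B.toStarSubalgebra, τ b = inner ℂ η (amp ℕ (b : H →L[ℂ] H) ξ))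
    (hα : PreservesTrace τ α) (x : (crossedProduct B α).toStarSubalgebra) :
    sliceOp e η ξ (x : EllTwo Γ H →L[ℂ] EllTwo Γ H) ∈ (vonNeumannGenerated
      (Set.range (translation : Γ → EllTwo Γ H →L[ℂ] EllTwo Γ H))).toStarSubalgebra := by
  rw [← SetLike.mem_coe, coe_vonNeumannGenerated]
  intro R hR
  have h1 : ∀ (y : EllTwo Γ H →L[ℂ] EllTwo Γ H) (f f' : EllTwo Γ H),
      inner ℂ f ((sliceOp e η ξ y * R) f') =
        inner ℂ (sliceMap Γ e η f) (amp (I × ℕ) y (sliceMap Γ e ξ (R f'))) :=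
    fun y f f' => inner_sliceOp e η ξ y f (R f')
  have h2 : ∀ (y : EllTwo Γ H →L[ℂ] EllTwo Γ H) (f f' : EllTwo Γ H),
      inner ℂ f ((R * sliceOp e η ξ y) f') =
        inner ℂ (sliceMap Γ e η (R.adjoint f)) (amp (I × ℕ) y (sliceMap Γ e ξ f')) := by
    intro y f f'
    rw [← inner_sliceOp, ContinuousLinearMap.adjoint_inner_left, mul_apply_eq_comp]
  refine ContinuousLinearMap.ext fun f' => ext_inner_left ℂ fun f => ?_
  rw [h1, h2]
  symm
  refine inner_amp_eq_of_mem_centralizer_centralizer (one_mem_crossedMonomials B α)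
    (mul_mem_crossedMonomials B α) (star_mem_crossedMonomials B α) ?_
    (crossedProduct_subset B α x.2)
  rintro _ ⟨⟨b, g⟩, rfl⟩
  rw [← h1, ← h2, sliceOp_monomial e h hα, smul_mul_assoc, mul_smul_comm,
    hR _ (Or.inl ⟨g, rfl⟩)]

theorem unitCorner_sliceOp_mul_translation (e : HilbertBasis I ℂ H) {η ξ : EllTwo ℕ H}
    (h : ∀ b : B.toStarSubalgebra, τ b = inner ℂ η (amp ℕ (b : H →L[ℂ] H) ξ))
    (x : (crossedProduct B α).toStarSubalgebra) (g : Γ) (w : H) :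
    unitCorner (sliceOp e η ξ (x : EllTwo Γ H →L[ℂ] EllTwo Γ H) * translation g) w =
      crossedTrace B α τ (x * (translationHom B α g : unitary _)) • w := by
  rw [unitCorner_apply_delta, mul_apply_eq_comp, translation_delta, mul_one]
  refine sliceOp_delta_apply e η ξ _ 1 g w ?_
  rw [crossedTrace_eq_inner_amp h]
  refine (hasSum_inner_amp _ _ _).congr_fun fun n => ?_
  rw [deltaOne_apply, deltaOne_apply, inner_delta_left, MulMemClass.coe_mul, mul_apply_eq_comp,
    coe_translationHom, translation_delta, mul_one]

theorem translationAlgebra_le_crossedProduct :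
    (vonNeumannGenerated
      (Set.range (translation : Γ → EllTwo Γ H →L[ℂ] EllTwo Γ H))).toStarSubalgebra ≤
      (crossedProduct B α).toStarSubalgebra := by
  rw [← SetLike.coe_subset_coe, crossedProduct, coe_vonNeumannGenerated, coe_vonNeumannGenerated]
  refine Set.centralizer_subset (Set.centralizer_subset (Set.union_subset_union ?_ ?_))
  · exact Set.subset_union_right
  · exact fun y hy => Or.inr hy

theorem exists_isConditionalExpectation (hτ : IsNormalFaithfulTrace B τ)
    (hα : PreservesTrace τ α) :
    ∃ E, IsConditionalExpectation (crossedTrace B α τ) (crossedGroupAlgebra B α) E := by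
  obtain ⟨η, ξ, h⟩ := hτ.exists_inner_amp
  obtain ⟨I, e, -⟩ := exists_hilbertBasis ℂ H
  have hmem := fun x => sliceOp_mem e h hα x
  refine ⟨fun x => ⟨sliceOp e η ξ x, translationAlgebra_le_crossedProduct (hmem x)⟩,
    fun x => ⟨hmem x, fun a ha => ?_⟩⟩
  set y : (crossedProduct B α).toStarSubalgebra :=
    ⟨sliceOp e η ξ x, translationAlgebra_le_crossedProduct (hmem x)⟩ with hy
  have h1 : ∀ z a : (crossedProduct B α).toStarSubalgebra, crossedTrace B α τ (z * a) =
      inner ℂ (amp ℕ (star (z : EllTwo Γ H →L[ℂ] EllTwo Γ H)) (deltaOne Γ η))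
        (amp ℕ (a : EllTwo Γ H →L[ℂ] EllTwo Γ H) (deltaOne Γ ξ)) := fun z a => by
    rw [inner_amp_left, star_star]
    exact crossedTrace_eq_inner_amp h _
  rw [h1, h1]
  -- Both sides are normal in `a`, so only `a = λ(g)` needs checking; there the corner of the slice
  -- times `λ(g)` is the scalar `T(x λ(g))`.
  refine inner_amp_eq_of_mem_centralizer_centralizer (S := Set.range translation)
    ⟨1, translation_one⟩ ?_ ?_ ?_ (translationAlgebra_subset ha)
  · rintro _ ⟨g, rfl⟩ _ ⟨k, rfl⟩
    exact ⟨g * k, translation_mul g k⟩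
  · rintro _ ⟨g, rfl⟩
    exact ⟨g⁻¹, (star_translation g).symm⟩
  · rintro _ ⟨g, rfl⟩
    rw [← coe_translationHom B α g, ← h1, ← h1, crossedTrace_apply]
    have : crossedExpectation B α (y * (translationHom B α g : unitary _)) =
        crossedTrace B α τ (x * (translationHom B α g : unitary _)) • 1 :=
      Subtype.ext (ContinuousLinearMap.ext fun w =>
        unitCorner_sliceOp_mul_translation e h x g w)
    rw [this, map_smul, hτ.map_one, smul_eq_mul, mul_one]

theorem isCrossedSystem_crossedProduct (hτ : IsNormalFaithfulTrace B τ)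
    (hα : PreservesTrace τ α) :
    IsCrossedSystem τ α (crossedTrace B α τ) (crossedGroupAlgebra B α) (crossedRepHom B α)
      (translationHom B α) (crossedExpectation B α) where
  map_one := hτ.map_one
  tracial_base := hτ.tracial
  invariant := hα
  trace_eq := crossedTrace_apply
  nonneg := crossedTrace_nonneg hτ
  faithful := crossedTrace_faithful hτ hα
  tracial := crossedTrace_mul_comm hτ hα
  map_rep_mul := crossedExpectation_rep_mul B α
  map_mul_rep := crossedExpectation_mul_rep B α
  map_unitary _ := crossedExpectation_translationHom
  covariant g b := Subtype.ext (translation_mul_crossedRep B α g b)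
  parseval := hasSum_crossedTrace_star_mul_self hτ
  unitary_mem g := subset_vonNeumannGenerated _ ⟨g, rfl⟩
  map_eq_smul_one := crossedExpectation_eq_smul_one hτ
  map_one' := crossedExpectation_one
  bounded := (crossedProduct B α).exists_twoNormSq_mul_le (crossedTrace_nonneg hτ)
  exists_conditionalExpectation := exists_isConditionalExpectation hτ hα

end SliceExpectation

end

theorem proposition2p2 {H : Type*} [NormedAddCommGroup H] [InnerProductSpace ℂ H] [CompleteSpace H]
    {Γ₀ : Type*} [CommGroup Γ₀]
    (B : VonNeumannAlgebra H)
    (τ : B.toStarSubalgebra →ₗ[ℂ] ℂ) (hτ : IsNormalFaithfulTrace B τ)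
    (α : Γ₀ →* (B.toStarSubalgebra ≃⋆ₐ[ℂ] B.toStarSubalgebra)) (hα : PreservesTrace τ α) :
    IsWeaklyMixingIn (crossedTrace B α τ) (crossedGroupAlgebra B α) ↔
      IsWeaklyMixingAction τ α :=
  ⟨(isCrossedSystem_crossedProduct hτ hα).isWeaklyMixingAction,
    (isCrossedSystem_crossedProduct hτ hα).isWeaklyMixingIn⟩
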